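/- Fix an optimal description language for plain Kolmogorov complexity $C$ of binary strings, and a discrete a priori probability $\mathbf m$ (a lower semicomputable semimeasure on binary strings that is maximal up to constant factors); finite sets and tuples of strings are encoded as strings by a fixed computable encoding. Let $\mathcal A$ be a decidable family of finite sets of binary strings, and let $\mathcal A^n$ be the family of all $A\in\mathcal A$ with $A\subseteq\{0,1\}^n$. Let $l\ge 1$ and let $\vec x=(x_1,\dots,x_l)$ be a tuple of strings of length $n$. Write $\vec x\in A$ if all $x_i$ belong to $A$. For $\vec x\in A\in\mathcal A^n$ put $$\delta(\vec x,A)=C(A)+l\log_2|A|-C(\vec x).$$ For a real number $d$, the *$\mathcal A$-algorithmic prediction $d$-neighborhood* of $\vec x$ is the union of all sets $A\in\mathcal A^n$ with $\vec x\in A$ such that $\delta(\vec x,A)\le\delta(\vec x,B)+d$ for every $B\in\mathcal A^n$ with $\vec x\in B$. Let $$p_{\mathcal A}(y\mid\vec x)=\frac{\sum_{A\ni \vec x,y}\mathbf m(A)/|A|^l}{\sum_{A\ni\vec x}\mathbf m(A)/|A|^l},$$ where both sums are over the sets $A\in\mathcal A^n$ with $C(A)\le (l+3)n$, and $p_{\mathcal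 A}(y\mid\vec x)=0$ if no such set contains $\vec x$. The *$\mathcal A$-probabilistic prediction $d$-neighborhood* of $\vec x$ is the set of all strings $y$ with $p_{\mathcal A}(y\mid\vec x)\ge 2^{-d}$. Theorem. There are constants $c$ and $N$, depending only on $\mathcal A$ and on the choice of $C$ and $\mathbf m$, such that for all $n\ge 0$ and $l\ge1$, every $l$-tuple $\vec x$ of $n$-bit strings and every real $d$ (in particular, every integer $d$): (a) if $n\ge 1$ and $n+l\ge N$, then the $\mathcal A$-algorithmic prediction $d$-neighborhood of $\vec x$ is contained in the $\mathcal A$-probabilistic prediction $(d+c\log_2(n+l))$-neighborhood of $\vec x$; (b) the $\mathcal A$-probabilistic prediction $d$-neighborhood of $\vec x$ is contained in the $\mathcal A$-algorithmic prediction $(d+c\log_2(n+l))$-neighborhood of $\vec x$. -/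

import Mathlib

namespace AlgStat

noncomputable section

/-- Binary strings. -/
abbrev Str : Type := List Bool

/-- The binary code of a finite list of strings: each string is written with every bit doubled and
is followed by the end marker `10`. -/
def listCode (L : List Str) : Str :=
  L.flatMap fun w => (w.flatMap fun b => [b, b]) ++ [true, false]

/-- The binary code of a finite set of strings: the code of the list of its elements in
lexicographical order. -/
def setCode (A : Finset Str) : Str :=
  listCode (A.sort (· ≤ ·))

/-- The code of a list of strings determines the list. -/
theorem listCode_injective : Function.Injective listCode := by
  have key : ∀ (v w r s : Str),
      (v.flatMap fun b => [b, b]) ++ [true, false] ++ r =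
        (w.flatMap fun b => [b, b]) ++ [true, false] ++ s → v = w ∧ r = s := by
    intro v
    induction v with
    | nil =>
      intro w r s h
      cases w with
      | nil => simpa using h
      | cons b w => cases b <;> simp at h
    | cons a v ih =>
      intro w r s h
      cases w with
      | nil => cases a <;> simp at h
      | cons b w =>
        have h' : a = b ∧ (v.flatMap fun b => [b, b]) ++ [true, false] ++ r =
            (w.flatMap fun b => [b, b]) ++ [true, false] ++ s := by
          simpa using h
        obtain ⟨h1, h2⟩ := ih w r s h'.2
        exact ⟨by rw [h'.1, h1], h2⟩
  intro L
  induction L with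
  | nil =>
    intro M h
    cases M with
    | nil => rfl
    | cons w M => simp [listCode] at h
  | cons v L ih =>
    intro M h
    cases M with
    | nil => simp [listCode] at h
    | cons w M =>
      simp only [listCode, List.flatMap_cons] at h
      obtain ⟨h1, h2⟩ := key _ _ _ _ h
      rw [h1, ih h2]

/-- The code of a finite set determines the set. -/
theorem setCode_injective : Function.Injective setCode := by
  intro A B h
  have h1 := listCode_injective h
  rw [← Finset.sort_toFinset (s := A) (r := (· ≤ ·)), h1, Finset.sort_toFinset]

/-- `D` is an optimal description language (decompressor) for plain Kolmogorov complexity: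
it is partial computable, and for every partial computable `D'` there is a constant `c` such that
every description under `D'` can be replaced by a description of the same string under `D` that is
at most `c` bits longer. -/
def IsOptimal (D : Str →. Str) : Prop :=
  Partrec D ∧ ∀ D' : Str →. Str, Partrec D' →
    ∃ c : ℕ, ∀ p z, z ∈ D' p → ∃ q, z ∈ D q ∧ q.length ≤ p.length + c

/-- Plain Kolmogorov complexity of a string with respect to `D`: the minimal length of a
program that produces the string. -/
def complexity (D : Str →. Str) (z : Str) : ℕ :=
  sInf {k | ∃ p : Str, p.length = k ∧ z ∈ D p}

/-- Plain Kolmogorov complexity of a finite set of strings. -/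
def setComplexity (D : Str →. Str) (A : Finset Str) : ℕ :=
  complexity D (setCode A)

/-- Plain Kolmogorov complexity of a tuple of strings. -/
def tupleComplexity (D : Str →. Str) {l : ℕ} (x : Fin l → Str) : ℕ :=
  complexity D (listCode (List.ofFn x))

/-- Lower semicomputable semimeasures on binary strings: non-negative, of total mass at most `1`,
and such that the pairs of a non-negative rational `a / (b + 1)` and a string `z` with
`a / (b + 1) < μ z` can be enumerated by an algorithm. -/
structure IsLowerSemicomputableSemimeasure (μ : Str → ℝ) : Prop where
  nonneg : ∀ z, 0 ≤ μ z
  sum_le_one : ∀ s : Finset Str, ∑ z ∈ s, μ z ≤ 1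
  enumerable : REPred fun q : (ℕ × ℕ) × Str => (q.1.1 : ℝ) / ((q.1.2 : ℝ) + 1) < μ q.2

/-- `m` is a discrete a priori probability: a lower semicomputable semimeasure that is maximal
up to constant factors. -/
def IsAPrioriProbability (m : Str → ℝ) : Prop :=
  IsLowerSemicomputableSemimeasure m ∧
    ∀ μ : Str → ℝ, IsLowerSemicomputableSemimeasure μ →
      ∃ c : ℝ, 0 < c ∧ ∀ z, μ z ≤ c * m z

/-- A family of finite sets of strings is decidable: there is an algorithm that, given a finite
list of strings, decides whether the set of its entries is in the family. -/
def IsDecidableFamily (𝒜 : Set (Finset Str)) : Prop :=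
  ComputablePred fun L : List Str => L.toFinset ∈ 𝒜

/-- The set of all strings of length `n`. -/
def cube (n : ℕ) : Finset Str :=
  Finset.univ.image fun v : Fin n → Bool => List.ofFn v

theorem mem_cube {n : ℕ} {z : Str} : z ∈ cube n ↔ z.length = n := by
  simp only [cube, Finset.mem_image, Finset.mem_univ, true_and]
  constructor
  · rintro ⟨v, rfl⟩
    simp
  · rintro rfl
    exact ⟨z.get, List.ofFn_get z⟩

open Classical in
/-- The members of `𝒜` that consist of strings of length `n` and contain all entries of `x`. -/
def models (𝒜 : Set (Finset Str)) (n : ℕ) {l : ℕ} (x : Fin l → Str) : Finset (Finset Str) :=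
  (cube n).powerset.filter fun A => A ∈ 𝒜 ∧ ∀ i, x i ∈ A

/-- Optimality deficiency `C(A) + l log₂ |A| - C(x)` of `A` as a model for the tuple `x`. -/
def deficiency (D : Str →. Str) {l : ℕ} (x : Fin l → Str) (A : Finset Str) : ℝ :=
  (setComplexity D A : ℝ) + l * Real.logb 2 (A.card : ℝ) - (tupleComplexity D x : ℝ)

/-- The `𝒜`-algorithmic prediction `d`-neighbourhood of the tuple `x` of `n`-bit strings: the union
of all models whose deficiency exceeds that of every other model by at most `d`. -/
def algNeighborhood (D : Str →. Str) (𝒜 : Set (Finset Str)) (n : ℕ) {l : ℕ} (x : Fin l → Str)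
    (d : ℝ) : Set Str :=
  {y | ∃ A ∈ models 𝒜 n x,
    (∀ B ∈ models 𝒜 n x, deficiency D x A ≤ deficiency D x B + d) ∧ y ∈ A}

open Classical in
/-- The conditional probability `p(y | x)`: the ratio of the sums of `m(A) / |A| ^ l` over the
models `A` for `x` of complexity at most `(l + 3) n`, those that contain `y` in the numerator and
all of them in the denominator; it is `0` if there are no such models. -/
def predProb (D : Str →. Str) (m : Str → ℝ) (𝒜 : Set (Finset Str)) (n : ℕ) {l : ℕ}
    (x : Fin l → Str) (y : Str) : ℝ :=
  (∑ A ∈ (models 𝒜 n x).filter (fun A => setComplexity D A ≤ (l + 3) * n ∧ y ∈ A),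
      m (setCode A) / (A.card : ℝ) ^ l) /
    ∑ A ∈ (models 𝒜 n x).filter (fun A => setComplexity D A ≤ (l + 3) * n),
      m (setCode A) / (A.card : ℝ) ^ l

/-- The `𝒜`-probabilistic prediction `d`-neighbourhood of the tuple `x` of `n`-bit strings. -/
def probNeighborhood (D : Str →. Str) (m : Str → ℝ) (𝒜 : Set (Finset Str)) (n : ℕ) {l : ℕ}
    (x : Fin l → Str) (d : ℝ) : Set Str :=
  {y | (2 : ℝ) ^ (-d) ≤ predProb D m 𝒜 n x y}

end

end AlgStat

/-! Put cost(A) = 2^C(A) · |A|^l. Minimising the deficiency means minimising the cost, so y lies in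
the algorithmic d-neighborhood exactly when the least cost of a model containing x and y is at most
2^d times the least cost of a model containing x. It therefore suffices to show that each of the two
sums in p(y | x) is, up to a factor polynomial in n + l, the inverse of the least cost of its
models; a polynomial factor is an additive O(log(n + l)) in d.

Since m(A) equals 2^(-C(A)) up to a factor polynomial in C(A), and C(A) ≤ (l + 3)n, each summand is
1/cost(A) up to such a factor. One summand already gives the lower bound on the sum. The upper bound
needs that many models of one kind force a cheaper one (`exists_simple_model`): if about 2^e sets of
complexity at most k and bounded size contain the tuple X, then some set of the same size bound
containing X has complexity about k - e. For this, the sets are enumerated and an online algorithm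
marks about 2^(k-e) of them so that every tuple lying in about 2^e of them (times a polynomial) lies
in a marked one. A marked set is described by its number among the marked ones. The algorithm is a
deterministic multiplicative-weights strategy: a set capturing much weight of uncovered tuples is
marked, and otherwise the weights of its tuples grow.

The restriction C(A) ≤ (l + 3)n loses nothing for large n + l: a more complex model can be replaced
by the first smallest member of the family containing the l + 1 given strings, which these strings
and n determine (`exists_cheap_model`). `sum_inv_cost_le` sums over the polynomially many classes of
models, and `exists_mixture_bounds` gives the two-sided estimate. -/

namespace AlgStat

/-! ### Recursively enumerable predicates and enumerations without repetition. -/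

section Enumerability

variable {α β : Type} [Primcodable α] [Primcodable β]

/-- Halting within a given number of steps is primitive recursive. This staged form is what makes
dovetailed searches possible below. -/
theorem exists_primrec_of_rePred {p : α → Prop} (hp : REPred p) :
    ∃ f : α → ℕ → Bool, Primrec₂ f ∧ ∀ a, p a ↔ ∃ n, f a n = true := by
  have hp' : Partrec fun a => Part.assert (p a) fun _ => Part.some () := hp
  obtain ⟨c, hc⟩ := Nat.Partrec.Code.exists_code.1 hp'
  refine ⟨fun a n => (Nat.Partrec.Code.evaln n c (Encodable.encode a)).isSome, ?_, fun a => ?_⟩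
  · exact Primrec.option_isSome.comp (Nat.Partrec.Code.primrec_evaln.comp
      (.pair (.pair Primrec.snd (Primrec.const c)) (Primrec.encode.comp Primrec.fst)))
  · have h : p a ↔ ∃ x, x ∈ c.eval (Encodable.encode a) := by
      rw [hc]
      simp [Part.mem_assert_iff]
    rw [h]
    simp only [Nat.Partrec.Code.evaln_complete, Option.isSome_iff_exists, Option.mem_def]
    exact exists_comm

theorem rePred_exists_nat {p : α → ℕ → Prop} (hp : ComputablePred fun q : α × ℕ => p q.1 q.2) :
    REPred fun a => ∃ n, p a n := by
  classical
  have h : REPred fun a => (Nat.rfind fun n => (Part.some (decide (p a n)) : Part Bool)).Dom :=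
    (Partrec.rfind (p := fun a n => Part.some (decide (p a n)))
      (by exact hp.decide.partrec)).dom_re
  refine h.of_eq fun a => ?_
  refine Nat.rfind_dom.trans ?_
  constructor
  · rintro ⟨n, hn, -⟩
    exact ⟨n, by simpa using hn⟩
  · rintro ⟨n, hn⟩
    exact ⟨n, by simpa using hn, fun _ => trivial⟩

theorem rePred_comp {p : β → Prop} (hp : REPred p) {f : α → β} (hf : Computable f) :
    REPred fun a => p (f a) :=
  Partrec.comp hp hf

theorem rePred_exists {p : α → β → Prop} (hp : REPred fun q : α × β => p q.1 q.2) :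
    REPred fun a => ∃ b, p a b := by
  obtain ⟨f, hf, hfp⟩ := exists_primrec_of_rePred hp
  have h : REPred fun a => ∃ n : ℕ, ∃ b ∈ (Encodable.decode n.unpair.1 : Option β),
      f (a, b) n.unpair.2 = true := by
    refine rePred_exists_nat (ComputablePred.of_eq (p := fun q : α × ℕ =>
      ((Encodable.decode q.2.unpair.1 : Option β).map
        fun b => f (q.1, b) q.2.unpair.2) = some true) ?_ ?_)
    · refine PrimrecPred.computablePred (Primrec.eq.comp ?_ (Primrec.const _))
      have h1 : Primrec fun q : α × ℕ => q.2.unpair := Primrec.unpair.comp Primrec.snd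
      refine Primrec.option_map (Primrec.decode.comp (Primrec.fst.comp h1)) ?_
      exact hf.comp (.pair (Primrec.fst.comp Primrec.fst) Primrec.snd)
        (Primrec.snd.comp (h1.comp Primrec.fst))
    · intro q
      simp [Option.map_eq_some_iff]
  refine h.of_eq fun a => ⟨?_, ?_⟩
  · rintro ⟨n, b, -, h⟩
    exact ⟨b, (hfp (a, b)).2 ⟨_, h⟩⟩
  · rintro ⟨b, h⟩
    obtain ⟨n, hn⟩ := (hfp (a, b)).1 h
    exact ⟨Nat.pair (Encodable.encode b) n, b, by simp, by simpa using hn⟩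

theorem rePred_and {p q : α → Prop} (hp : REPred p) (hq : REPred q) :
    REPred fun a => p a ∧ q a := by
  have h : Partrec fun a => (Part.assert (p a) fun _ => Part.some ()).bind
      fun _ => Part.assert (q a) fun _ => Part.some () :=
    Partrec.bind hp (Partrec.comp hq Computable.fst)
  refine h.dom_re.of_eq fun a => ?_
  simp [Part.bind_dom, Part.assert]

theorem rePred_mem {f : α →. β} (hf : Partrec f) : REPred fun q : α × β => q.2 ∈ f q.1 := by
  classical
  have h1 : REPred fun q : β × β => q.1 = q.2 :=
    (PrimrecPred.computablePred (Primrec.eq (α := β))).to_re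
  have h : Partrec fun q : α × β => (f q.1).bind
      fun b => Part.assert (b = q.2) fun _ => Part.some () := by
    refine Partrec.bind (hf.comp Computable.fst) ?_
    exact Partrec.comp h1 (.pair Computable.snd (Computable.snd.comp Computable.fst))
  refine h.dom_re.of_eq fun q => ?_
  constructor
  · rintro ⟨h, h', -⟩
    exact ⟨h, h'⟩
  · rintro ⟨h, h'⟩
    exact ⟨h, h', trivial⟩

/-- Lets a decompressor be specified by its r.e. graph: search for any stage certifying some output;
uniqueness makes the answer the right one. -/
theorem exists_partrec_of_graph {G : α → β → Prop} (hG : REPred fun q : α × β => G q.1 q.2)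
    (huniq : ∀ a b b', G a b → G a b' → b = b') :
    ∃ f : α →. β, Partrec f ∧ ∀ a b, b ∈ f a ↔ G a b := by
  obtain ⟨f, hf, hfp⟩ := exists_primrec_of_rePred hG
  let F : α → ℕ → Option β := fun a n => (Encodable.decode n.unpair.1 : Option β).bind
    fun b => if f (a, b) n.unpair.2 = true then some b else none
  have hF : Primrec₂ F := by
    have h1 : Primrec fun q : α × ℕ => q.2.unpair := Primrec.unpair.comp Primrec.snd
    refine Primrec.option_bind (Primrec.decode.comp (Primrec.fst.comp h1)) ?_
    refine Primrec.ite (Primrec.eq.comp ?_ (Primrec.const _))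
      (Primrec.option_some.comp Primrec.snd) (Primrec.const _)
    exact hf.comp (.pair (Primrec.fst.comp Primrec.fst) Primrec.snd)
        (Primrec.snd.comp (h1.comp Primrec.fst))
  have hFG : ∀ a n b, b ∈ F a n → G a b := by
    intro a n b h
    simp only [F, Option.mem_def, Option.bind_eq_some_iff] at h
    obtain ⟨b', -, h⟩ := h
    split_ifs at h with h'
    cases h
    exact (hfp (a, b)).2 ⟨_, h'⟩
  refine ⟨fun a => Nat.rfindOpt (F a), Partrec.rfindOpt hF.to_comp, fun a b => ⟨?_, ?_⟩⟩
  · intro h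
    obtain ⟨n, hn⟩ := Nat.rfindOpt_spec h
    exact hFG a n b hn
  · intro h
    obtain ⟨n, hn⟩ := (hfp (a, b)).1 h
    have hb : b ∈ F a (Nat.pair (Encodable.encode b) n) := by
      simp [F, hn]
    have hd : (Nat.rfindOpt (F a)).Dom := Nat.rfindOpt_dom.2 ⟨_, _, hb⟩
    obtain ⟨k, hk⟩ := Nat.rfindOpt_spec (Part.get_mem hd)
    rw [huniq a b _ h (hFG a k _ hk)]
    exact Part.get_mem hd

/-- An enumeration of an r.e. family of sets without repetitions. -/
theorem exists_primrec_enumeration {R : α → β → Prop}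
    (hR : REPred fun q : α × β => R q.1 q.2) :
    ∃ e : α → ℕ → Option β, Primrec₂ e ∧ (∀ a b, R a b ↔ ∃ t, e a t = some b) ∧
      ∀ a t t' b, e a t = some b → e a t' = some b → t = t' := by
  obtain ⟨f, hf, hfp⟩ := exists_primrec_of_rePred hR
  -- Counting only the least certifying stage, together with the test `Encodable.encode b =
  -- n.unpair.1` that excludes other codes decoding to `b`, makes every element appear at exactly
  -- one time.
  have hleast : PrimrecPred fun q : (α × β) × ℕ =>
      f q.1 q.2 = true ∧ ∀ k < q.2, ¬ f q.1 k = true := by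
    refine PrimrecPred.and (Primrec.eq.comp hf (Primrec.const _)) ?_
    have h : PrimrecRel fun (k : ℕ) (q : α × β) => ¬ f q k = true :=
      PrimrecPred.not (Primrec.eq.comp (hf.comp Primrec.snd Primrec.fst) (Primrec.const _))
    have h' : PrimrecPred fun q : (α × β) × ℕ => ∀ k ∈ List.range q.2, ¬ f q.1 k = true :=
      h.forall_mem_list.comp (Primrec.list_range.comp Primrec.snd) Primrec.fst
    simpa using h'
  classical
  let e : α → ℕ → Option β := fun a n => (Encodable.decode n.unpair.1 : Option β).bind
    fun b => if (f (a, b) n.unpair.2 = true ∧ ∀ k < n.unpair.2, ¬ f (a, b) k = true) ∧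
      Encodable.encode b = n.unpair.1 then some b else none
  have he : Primrec₂ e := by
    have h1 : Primrec fun q : α × ℕ => q.2.unpair := Primrec.unpair.comp Primrec.snd
    refine Primrec.option_bind (Primrec.decode.comp (Primrec.fst.comp h1)) ?_
    refine Primrec.ite (PrimrecPred.and ?_ ?_)
      (Primrec.option_some.comp Primrec.snd) (Primrec.const _)
    · exact hleast.comp (Primrec.pair (.pair (Primrec.fst.comp Primrec.fst) Primrec.snd)
        (Primrec.snd.comp (h1.comp Primrec.fst)))
    · exact Primrec.eq.comp (Primrec.encode.comp Primrec.snd)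
        (Primrec.fst.comp (h1.comp Primrec.fst))
  have key : ∀ a t b, e a t = some b ↔ (f (a, b) t.unpair.2 = true ∧
      ∀ k < t.unpair.2, ¬ f (a, b) k = true) ∧ Encodable.encode b = t.unpair.1 := by
    intro a t b
    simp only [e, Option.bind_eq_some_iff]
    constructor
    · rintro ⟨b', -, h⟩
      split_ifs at h with h'
      cases h
      exact h'
    · intro h
      exact ⟨b, by rw [← h.2, Encodable.encodek], if_pos h⟩
  refine ⟨e, he, fun a b => ⟨fun h => ?_, ?_⟩, ?_⟩
  · have h' := (hfp (a, b)).1 h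
    refine ⟨Nat.pair (Encodable.encode b) (Nat.find h'), (key _ _ _).2 ?_⟩
    simp only [Nat.unpair_pair, and_true]
    exact ⟨Nat.find_spec h', fun k hk => Nat.find_min h' hk⟩
  · rintro ⟨t, ht⟩
    exact (hfp (a, b)).2 ⟨_, ((key _ _ _).1 ht).1.1⟩
  · intro a t t' b h h'
    obtain ⟨⟨h1, h2⟩, h3⟩ := (key _ _ _).1 h
    obtain ⟨⟨h1', h2'⟩, h3'⟩ := (key _ _ _).1 h'
    have h4 : t.unpair.2 = t'.unpair.2 := by
      rcases lt_trichotomy t.unpair.2 t'.unpair.2 with hlt | heq | hlt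
      · exact absurd h1 (h2' _ hlt)
      · exact heq
      · exact absurd h1' (h2 _ hlt)
    rw [← Nat.pair_unpair t, ← Nat.pair_unpair t', h4, ← h3, ← h3']

end Enumerability

/-! ### Lexicographic lists of words and self-delimiting codes. -/

section Words

variable {α : Type}

/-- The words of length `k` over the alphabet listed by `S`, in lexicographical order. -/
def words (S : List α) : ℕ → List (List α)
  | 0 => [[]]
  | k + 1 => S.flatMap fun a => (words S k).map (List.cons a)

theorem mem_words {S : List α} {k : ℕ} {w : List α} :
    w ∈ words S k ↔ w.length = k ∧ ∀ a ∈ w, a ∈ S := by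
  induction k generalizing w with
  | zero => cases w <;> simp [words]
  | succ k ih =>
    cases w with
    | nil => simp [words]
    | cons b w => simp [words, ih]; tauto

theorem length_words (S : List α) (k : ℕ) : (words S k).length = S.length ^ k := by
  induction k with
  | zero => rfl
  | succ k ih =>
    simp [words, List.length_flatMap, ih, pow_succ']

theorem nodup_words {S : List α} (hS : S.Nodup) (k : ℕ) : (words S k).Nodup := by
  induction k with
  | zero => simp [words]
  | succ k ih =>
    rw [words, List.nodup_flatMap]
    refine ⟨fun a _ => ih.map (List.cons_injective), hS.imp ?_⟩
    intro a b hab w h1 h2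
    simp only [List.mem_map] at h1 h2
    obtain ⟨v, -, rfl⟩ := h1
    obtain ⟨u, -, h⟩ := h2
    exact hab (List.cons.inj h).1.symm

theorem pairwise_lt_words [LinearOrder α] {S : List α} (hS : S.Pairwise (· < ·)) (k : ℕ) :
    (words S k).Pairwise (· < ·) := by
  induction k with
  | zero => simp [words]
  | succ k ih =>
    rw [words, List.pairwise_flatMap]
    refine ⟨fun a _ => ?_, hS.imp ?_⟩
    · rw [List.pairwise_map]
      exact ih.imp fun h => List.cons_lt_cons_iff.2 (Or.inr ⟨rfl, h⟩)
    · intro a b hab v hv w hw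
      simp only [List.mem_map] at hv hw
      obtain ⟨v, -, rfl⟩ := hv
      obtain ⟨w, -, rfl⟩ := hw
      exact List.cons_lt_cons_iff.2 (Or.inl hab)

theorem primrec_words [Primcodable α] : Primrec₂ (words : List α → ℕ → List (List α)) := by
  have h : Primrec₂ fun (S : List α) (W : List (List α)) =>
      S.flatMap fun a => W.map (List.cons a) :=
    Primrec.list_flatMap Primrec.fst (Primrec.list_map (Primrec.snd.comp Primrec.fst)
      (Primrec.list_cons.comp (Primrec.snd.comp Primrec.fst) Primrec.snd))
  have h' : Primrec₂ fun (S : List α) (q : ℕ × List (List α)) =>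
      S.flatMap fun a => q.2.map (List.cons a) :=
    h.comp Primrec.fst (Primrec.snd.comp Primrec.snd)
  refine Primrec.of_eq (Primrec.nat_rec (f := fun _ : List α => ([[]] : List (List α)))
    (Primrec.const _) h') ?_
  rintro ⟨S, k⟩
  simp only
  induction k with
  | zero => rfl
  | succ k ih => simp only [words, ← ih]

end Words

/-- The binary strings of length `n` in lexicographical order. -/
def binWords (n : ℕ) : List Str := words [false, true] n

theorem mem_binWords {n : ℕ} {w : Str} : w ∈ binWords n ↔ w.length = n := by
  simp only [binWords, mem_words, and_iff_left_iff_imp]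
  intro _ a _
  cases a <;> simp

theorem length_binWords (n : ℕ) : (binWords n).length = 2 ^ n := length_words _ _

theorem nodup_binWords (n : ℕ) : (binWords n).Nodup := nodup_words (by simp) n

theorem pairwise_lt_binWords (n : ℕ) : (binWords n).Pairwise (· < ·) :=
  pairwise_lt_words (by simp) n

theorem primrec_binWords : Primrec binWords :=
  (primrec_words (α := Bool)).comp (Primrec.const [false, true]) Primrec.id

theorem card_le_two_pow_of_length {s : ℕ} {F : Finset Str} (hF : ∀ q ∈ F, q.length = s) :
    F.card ≤ 2 ^ s := by
  rw [← length_binWords, ← List.toFinset_card_of_nodup (nodup_binWords s)]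
  exact Finset.card_le_card fun q hq => by simpa [mem_binWords] using hF q hq

/-- The value of a string in bijective binary notation, least significant digit first. -/
def strVal (w : Str) : ℕ := w.foldr (fun b v => 2 * v + (bif b then 2 else 1)) 0

theorem primrec_strVal : Primrec strVal := by
  have h : Primrec₂ fun (_ : Str) (q : Bool × ℕ) => 2 * q.2 + (bif q.1 then 2 else 1) := by
    refine Primrec.nat_add.comp (Primrec.nat_mul.comp (Primrec.const 2)
      (Primrec.snd.comp Primrec.snd)) ?_
    exact Primrec.cond (Primrec.fst.comp Primrec.snd) (Primrec.const 2) (Primrec.const 1)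
  exact Primrec.list_foldr Primrec.id (Primrec.const 0) h

theorem two_pow_length_le_strVal (w : Str) : 2 ^ w.length ≤ strVal w + 1 := by
  induction w with
  | nil => simp [strVal]
  | cons b w ih =>
    have h : strVal (b :: w) = 2 * strVal w + (bif b then 2 else 1) := rfl
    rw [h, List.length_cons, pow_succ]
    cases b <;> simp <;> omega

theorem strVal_surjective : Function.Surjective strVal := by
  intro a
  induction a using Nat.strong_induction_on with
  | _ a ih =>
    rcases a with _ | a
    · exact ⟨[], rfl⟩
    · obtain ⟨w, hw⟩ := ih (a / 2) (by omega)
      refine ⟨decide (a % 2 = 1) :: w, ?_⟩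
      have h : strVal (decide (a % 2 = 1) :: w) =
          2 * strVal w + (bif decide (a % 2 = 1) then 2 else 1) := rfl
      rw [h, hw]
      rcases Nat.mod_two_eq_zero_or_one a with h | h <;> simp [h] <;> omega

theorem primrec_listCode : Primrec listCode := by
  refine Primrec.list_flatMap (β := Str) Primrec.id
    (Primrec.list_append.comp ?_ (Primrec.const _))
  refine Primrec.list_flatMap Primrec.snd ?_
  exact Primrec.list_cons.comp Primrec.snd
    (Primrec.list_cons.comp Primrec.snd (Primrec.const []))

theorem length_listCode_singleton (w : Str) : (listCode [w]).length = 2 * w.length + 2 := by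
  have h : ∀ w : Str, (w.flatMap fun b => [b, b]).length = 2 * w.length := by
    intro w
    induction w with
    | nil => rfl
    | cons b w ih => simp [ih]; ring
  simp [listCode, h]

theorem listCode_singleton_append_inj {v w r s : Str}
    (h : listCode [v] ++ r = listCode [w] ++ s) : v = w ∧ r = s := by
  simp only [listCode, List.flatMap_cons, List.flatMap_nil, List.append_nil] at h
  induction v generalizing w with
  | nil =>
    cases w with
    | nil => simpa using h
    | cons b w => cases b <;> simp at h
  | cons a v ih =>
    cases w with
    | nil => cases a <;> simp at h
    | cons b w =>
      have h' : a = b ∧ (v.flatMap fun b => [b, b]) ++ [true, false] ++ r =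
          (w.flatMap fun b => [b, b]) ++ [true, false] ++ s := by
        simpa using h
      obtain ⟨h1, h2⟩ := ih h'.2
      exact ⟨by rw [h'.1, h1], h2⟩

/-! ### Counting simple strings and describing elements of enumerable sets. -/

section Complexity

variable {D : Str →. Str}

theorem complexity_le {p z : Str} (h : z ∈ D p) : complexity D z ≤ p.length :=
  Nat.sInf_le ⟨p, rfl, h⟩

theorem exists_program (hD : IsOptimal D) (z : Str) :
    ∃ p, p.length = complexity D z ∧ z ∈ D p := by
  obtain ⟨c, hc⟩ := hD.2 (fun p => Part.some p) Partrec.some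
  obtain ⟨q, hq, -⟩ := hc z z (Part.mem_some z)
  exact Nat.sInf_mem (s := {k | ∃ p : Str, p.length = k ∧ z ∈ D p}) ⟨_, q, rfl, hq⟩

theorem card_le_of_complexity_eq (hD : IsOptimal D) {k : ℕ} {F : Finset Str}
    (hF : ∀ z ∈ F, complexity D z = k) : F.card ≤ 2 ^ k := by
  choose p hp hpz using exists_program hD
  rw [← Finset.card_image_of_injective (f := p)]
  · refine card_le_two_pow_of_length fun q hq => ?_
    obtain ⟨z, hz, rfl⟩ := Finset.mem_image.1 hq
    rw [hp, hF z hz]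
  · intro z z' h
    have h1 := hpz z
    rw [h] at h1
    exact Part.mem_unique h1 (hpz z')

theorem card_le_of_complexity_le (hD : IsOptimal D) {k : ℕ} {F : Finset Str}
    (hF : ∀ z ∈ F, complexity D z ≤ k) : F.card ≤ 2 ^ (k + 1) := by
  have h : F = (Finset.range (k + 1)).biUnion fun j => F.filter fun z => complexity D z = j := by
    ext z
    simp only [Finset.mem_biUnion, Finset.mem_range, Finset.mem_filter]
    exact ⟨fun h => ⟨_, Nat.lt_succ_of_le (hF z h), h, rfl⟩, fun ⟨_, _, h, _⟩ => h⟩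
  rw [h]
  refine (Finset.card_biUnion_le).trans ?_
  refine (Finset.sum_le_sum (g := fun j => 2 ^ j) fun j _ => ?_).trans ?_
  · exact card_le_of_complexity_eq hD fun z hz => (Finset.mem_filter.1 hz).2
  · have := Nat.geomSum_eq (le_refl 2) (k + 1)
    rw [this]
    simp

/-- An element of an r.e. family of sets is described by the parameter of the set and the position
of the element in the enumeration. -/
theorem complexity_le_of_enumerable (hD : IsOptimal D) {R : ℕ → ℕ → Str → Prop}
    (hR : REPred fun q : (ℕ × ℕ) × Str => R q.1.1 q.1.2 q.2) :
    ∃ c : ℕ, ∀ a s z, (∀ F : Finset Str, (∀ y ∈ F, R a s y) → F.card ≤ 2 ^ s) → R a s z →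
      2 ^ complexity D z ≤ 2 ^ c * 2 ^ s * (a + 1) ^ 2 := by
  obtain ⟨e, he, heR, hinj⟩ :=
    exists_primrec_enumeration (R := fun (q : ℕ × ℕ) z => R q.1 q.2 z) hR
  let cnt : ℕ × ℕ → ℕ → ℕ := fun a t => ((List.range t).filterMap (e a)).length
  have hcnt : Primrec₂ cnt := by
    refine Primrec.list_length.comp (Primrec.listFilterMap
      (Primrec.list_range.comp Primrec.snd) ?_)
    exact he.comp (Primrec.fst.comp Primrec.fst) Primrec.snd
  have hcnt_lt : ∀ a t t', t < t' → (e a t).isSome → cnt a t < cnt a t' := by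
    intro a t t' htt' ht
    obtain ⟨b, hb⟩ := Option.isSome_iff_exists.1 ht
    have h1 : cnt a (t + 1) = cnt a t + 1 := by
      simp [cnt, List.range_succ, List.filterMap_append, hb]
    have h2 : cnt a (t + 1) ≤ cnt a t' := by
      obtain ⟨d, hd⟩ := Nat.exists_eq_add_of_le (Nat.succ_le_of_lt htt')
      simp only [cnt]
      rw [hd, Nat.succ_eq_add_one, List.range_add (n := t + 1), List.filterMap_append,
        List.length_append]
      exact Nat.le_add_right _ _
    omega
  let idx : Str → ℕ := fun q => @List.idxOf Str instBEqOfDecidableEq q (binWords q.length)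
  have hidx : Primrec idx := Primrec.list_idxOf.comp Primrec.id
    (primrec_binWords.comp Primrec.list_length)
  -- A program is a self-delimiting header coding `a`, followed by `s` raw bits giving the position
  -- of `z` in the enumeration. The number `s` is read off as the length of these bits, so it costs
  -- nothing.
  let G : Str → Str → Prop := fun p z => ∃ u : (Str × Str) × ℕ,
    (p = listCode [u.1.1] ++ u.1.2 ∧ cnt (strVal u.1.1, u.1.2.length) u.2 =
      idx u.1.2) ∧ e (strVal u.1.1, u.1.2.length) u.2 = some z
  have hG : REPred fun q : Str × Str => G q.1 q.2 := by
    refine rePred_exists (PrimrecPred.computablePred ?_).to_re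
    have hq : Primrec fun v : (Str × Str) × ((Str × Str) × ℕ) => v.2.1.2 :=
      Primrec.snd.comp (Primrec.fst.comp Primrec.snd)
    have hw : Primrec fun v : (Str × Str) × ((Str × Str) × ℕ) => v.2.1.1 :=
      Primrec.fst.comp (Primrec.fst.comp Primrec.snd)
    have hl : Primrec fun v : (Str × Str) × ((Str × Str) × ℕ) => v.2.1.2.length :=
      Primrec.list_length.comp hq
    have ha : Primrec fun v : (Str × Str) × ((Str × Str) × ℕ) =>
        (strVal v.2.1.1, v.2.1.2.length) := .pair (primrec_strVal.comp hw) hl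
    refine PrimrecPred.and (PrimrecPred.and ?_ ?_) ?_
    · refine Primrec.eq.comp (Primrec.fst.comp Primrec.fst) (Primrec.list_append.comp ?_ hq)
      exact primrec_listCode.comp (Primrec.list_cons.comp hw (Primrec.const []))
    · refine Primrec.eq.comp (hcnt.comp ha (Primrec.snd.comp Primrec.snd)) ?_
      exact hidx.comp hq
    · exact Primrec.eq.comp (he.comp ha (Primrec.snd.comp Primrec.snd))
        (Primrec.option_some.comp (Primrec.snd.comp Primrec.fst))
  obtain ⟨D', hD', hD'G⟩ := exists_partrec_of_graph hG <| by
    rintro p z z' ⟨⟨⟨w, q⟩, t⟩, ⟨h1, h2⟩, h3⟩ ⟨⟨⟨w', q'⟩, t'⟩, ⟨h1', h2'⟩, h3'⟩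
    simp only at h1 h2 h3 h1' h2' h3'
    obtain ⟨rfl, rfl⟩ := listCode_singleton_append_inj (h1.symm.trans h1')
    have ht : t = t' := by
      rcases lt_trichotomy t t' with h | h | h
      · have := hcnt_lt _ t t' h (by rw [h3]; rfl); omega
      · exact h
      · have := hcnt_lt _ t' t h (by rw [h3']; rfl); omega
    subst ht
    exact Option.some.inj (h3.symm.trans h3')
  obtain ⟨c, hc⟩ := hD.2 D' hD'
  -- The 2 pays for the end marker of the header. Doubling the bits of the header gives the square
  -- of `a + 1`.
  refine ⟨c + 2, fun a s z hcard hz => ?_⟩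
  obtain ⟨w, rfl⟩ := strVal_surjective a
  obtain ⟨t, ht⟩ := (heR (strVal w, s) z).1 hz
  have hlt : cnt (strVal w, s) t < (binWords s).length := by
    have hnd : ((List.range (t + 1)).filterMap (e (strVal w, s))).Nodup := by
      refine List.Nodup.filterMap ?_ List.nodup_range
      intro i j b hi hj
      exact hinj _ _ _ b hi hj
    have h1 := hcard ((List.range (t + 1)).filterMap (e (strVal w, s))).toFinset (by
      intro y hy
      simp only [List.mem_toFinset, List.mem_filterMap] at hy
      obtain ⟨i, -, hi⟩ := hy
      exact (heR (strVal w, s) y).2 ⟨i, hi⟩)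
    rw [List.toFinset_card_of_nodup hnd] at h1
    have h2 : cnt (strVal w, s) (t + 1) = cnt (strVal w, s) t + 1 := by
      simp [cnt, List.range_succ, List.filterMap_append, ht]
    rw [length_binWords]
    have h3 : cnt (strVal w, s) (t + 1) ≤ 2 ^ s := h1
    omega
  let q := (binWords s)[cnt (strVal w, s) t]
  have hqs : q.length = s := mem_binWords.1 (List.getElem_mem hlt)
  have hq : idx q = cnt (strVal w, s) t := by
    simp only [idx, hqs]
    exact @List.Nodup.idxOf_getElem Str instBEqOfDecidableEq _ _ (nodup_binWords s) _ _
  have hzD : z ∈ D' (listCode [w] ++ q) := by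
    rw [hD'G]
    refine ⟨((w, q), t), ⟨rfl, ?_⟩, ?_⟩
    · simp only [hqs, hq]
    · simp only [hqs, ht]
  obtain ⟨r, hr, hrl⟩ := hc _ _ hzD
  have h1 : complexity D z ≤ (c + 2) + s + (w.length + w.length) := by
    refine (complexity_le hr).trans (hrl.trans ?_)
    rw [List.length_append, length_listCode_singleton, hqs]
    omega
  calc 2 ^ complexity D z ≤ 2 ^ ((c + 2) + s + (w.length + w.length)) :=
        Nat.pow_le_pow_right (by norm_num) h1
    _ = 2 ^ (c + 2) * 2 ^ s * (2 ^ w.length) ^ 2 := by rw [pow_add, pow_add, pow_add]; ring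
    _ ≤ _ := Nat.mul_le_mul_left _ (Nat.pow_le_pow_left (two_pow_length_le_strVal w) 2)

end Complexity

theorem primrec_two_pow : Primrec fun n : ℕ => 2 ^ n := by
  have h : Primrec₂ fun (_ : ℕ) (q : ℕ × ℕ) => q.2 * 2 :=
    Primrec.nat_mul.comp (Primrec.snd.comp Primrec.snd) (Primrec.const 2)
  refine Primrec.of_eq (Primrec.nat_rec' Primrec.id (Primrec.const 1) h) fun n => ?_
  simp only [id]
  induction n with
  | zero => rfl
  | succ n ih => simp only [ih, pow_succ]

/-! ### The a priori probability against 2 to the power of minus plain complexity. -/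

section APriori

variable {D : Str →. Str} {m : Str → ℝ}

theorem IsLowerSemicomputableSemimeasure.le_one (hm : IsLowerSemicomputableSemimeasure m)
    (z : Str) : m z ≤ 1 := by
  simpa using hm.sum_le_one {z}

/-- At most 2^s strings have measure above 2^(-s), and they are enumerable given s, so each has
complexity at most s + O(1). The least such s for `z` satisfies m(z) ≤ 2 · 2^(-s). -/
theorem IsLowerSemicomputableSemimeasure.mul_two_pow_complexity_le (hD : IsOptimal D)
    (hm : IsLowerSemicomputableSemimeasure m) :
    ∃ c : ℝ, 0 < c ∧ ∀ z, m z * 2 ^ complexity D z ≤ c := by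
  obtain ⟨c, hc⟩ := complexity_le_of_enumerable hD
    (R := fun _ s z => (1 : ℝ) / 2 ^ s < m z) (by
      refine REPred.of_eq (rePred_comp hm.enumerable
        (f := fun q : (ℕ × ℕ) × Str => ((1, 2 ^ q.1.2 - 1), q.2)) (Primrec.to_comp ?_)) ?_
      · exact .pair (.pair (Primrec.const 1) (Primrec.nat_sub.comp
          (primrec_two_pow.comp (Primrec.snd.comp Primrec.fst)) (Primrec.const 1))) Primrec.snd
      · intro q
        have h : 1 ≤ 2 ^ q.1.2 := Nat.one_le_two_pow
        push_cast [h]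
        simp)
  refine ⟨2 ^ (c + 1), by positivity, fun z => ?_⟩
  rcases (hm.nonneg z).eq_or_lt with h0 | h0
  · rw [← h0, zero_mul]; positivity
  have hex : ∃ s : ℕ, (1 : ℝ) / 2 ^ s < m z := by
    obtain ⟨s, hs⟩ := exists_pow_lt_of_lt_one h0 (by norm_num : (1 / 2 : ℝ) < 1)
    exact ⟨s, by rwa [div_pow, one_pow] at hs⟩
  have hs := Nat.find_spec hex
  have hmin := fun k => Nat.find_min (m := k) hex
  set s := Nat.find hex
  have hs0 : s ≠ 0 := by
    intro h
    rw [h] at hs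
    have := hm.le_one z
    norm_num at hs
    linarith
  obtain ⟨r, hr⟩ := Nat.exists_eq_succ_of_ne_zero hs0
  have h1 : m z ≤ 1 / 2 ^ r := not_lt.1 (hmin r (by omega))
  have h2 := hc 0 s z (fun F hF => by
    have h3 : ∑ z ∈ F, (1 : ℝ) / 2 ^ s ≤ 1 :=
      (Finset.sum_le_sum fun y hy => (hF y hy).le).trans (hm.sum_le_one F)
    rw [Finset.sum_const, nsmul_eq_mul, mul_one_div, div_le_one (by positivity)] at h3
    exact_mod_cast h3) hs
  have h4 : (2 : ℝ) ^ complexity D z ≤ 2 ^ c * 2 ^ s := by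
    simp only [zero_add, one_pow, mul_one] at h2
    exact_mod_cast h2
  calc m z * 2 ^ complexity D z ≤ 1 / 2 ^ r * (2 ^ c * 2 ^ s) := by gcongr
    _ = 2 ^ (c + 1) := by
      rw [hr, pow_succ, pow_succ]
      field_simp

/-- The strings of complexity k number at most 2^k, so they contribute at most 1/((k+1)(k+2)), and
this series telescopes to 1. A short program for `z` certifies a lower bound on the value, whence
enumerability. Maximality of `m` then gives the converse estimate with a quadratic loss. -/
theorem isLowerSemicomputableSemimeasure_complexity (hD : IsOptimal D) :
    IsLowerSemicomputableSemimeasure fun z =>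
      ((2 : ℝ) ^ complexity D z * ((complexity D z + 1) * (complexity D z + 2)))⁻¹ where
  nonneg z := by positivity
  sum_le_one F := by
    obtain ⟨n, hn⟩ : ∃ n, ∀ z ∈ F, complexity D z < n := by
      refine ⟨F.sup (complexity D) + 1, fun z hz => Nat.lt_succ_of_le (Finset.le_sup hz)⟩
    rw [← Finset.sum_fiberwise_of_maps_to (g := complexity D) (t := Finset.range n)
      (fun z hz => Finset.mem_range.2 (hn z hz))]
    have htel : ∀ n : ℕ, ∑ k ∈ Finset.range n, (((k : ℝ) + 1) * (k + 2))⁻¹ = 1 - 1 / (n + 1) := by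
      intro n
      induction n with
      | zero => simp
      | succ n ih =>
        rw [Finset.sum_range_succ, ih]
        push_cast
        field_simp
        ring
    refine (Finset.sum_le_sum fun k _ => ?_).trans ((htel n).le.trans ?_)
    · rw [Finset.sum_congr rfl (g := fun _ => ((2 : ℝ) ^ k * ((k + 1) * (k + 2)))⁻¹)
        (fun z hz => by rw [(Finset.mem_filter.1 hz).2])]
      rw [Finset.sum_const, nsmul_eq_mul, mul_inv, ← mul_assoc]
      refine mul_le_of_le_one_left (by positivity) ?_
      rw [← div_eq_mul_inv, div_le_one (by positivity)]
      have := card_le_of_complexity_eq hD (F := F.filter fun z => complexity D z = k)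
        (fun z hz => (Finset.mem_filter.1 hz).2)
      exact_mod_cast this
    · have : (0 : ℝ) ≤ 1 / (n + 1) := by positivity
      linarith
  enumerable := by
    let g : ℕ → ℕ := fun k => 2 ^ k * ((k + 1) * (k + 2))
    have hg : Primrec g := by
      refine Primrec.nat_mul.comp primrec_two_pow (Primrec.nat_mul.comp ?_ ?_)
      · exact Primrec.nat_add.comp Primrec.id (Primrec.const 1)
      · exact Primrec.nat_add.comp Primrec.id (Primrec.const 2)
    have hmono : Monotone g := fun a b h =>
      Nat.mul_le_mul (Nat.pow_le_pow_right (by norm_num) h)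
        (Nat.mul_le_mul (by omega) (by omega))
    have h : REPred fun q : (ℕ × ℕ) × Str =>
        ∃ p : Str, q.2 ∈ D p ∧ q.1.1 * g p.length < q.1.2 + 1 := by
      refine rePred_exists (rePred_and ?_ (PrimrecPred.computablePred ?_).to_re)
      · exact rePred_comp (rePred_mem hD.1) (f := fun v : ((ℕ × ℕ) × Str) × Str => (v.2, v.1.2))
          (.pair Computable.snd (Computable.snd.comp Computable.fst))
      · refine Primrec.nat_lt.comp (Primrec.nat_mul.comp ?_ ?_) (Primrec.succ.comp ?_)
        · exact Primrec.fst.comp (Primrec.fst.comp Primrec.fst)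
        · exact hg.comp (Primrec.list_length.comp Primrec.snd)
        · exact Primrec.snd.comp (Primrec.fst.comp Primrec.fst)
    refine h.of_eq fun q => ?_
    have hq : ((q.1.1 : ℝ) / ((q.1.2 : ℝ) + 1) < ((2 : ℝ) ^ complexity D q.2 *
        ((complexity D q.2 + 1) * (complexity D q.2 + 2)))⁻¹) ↔
        q.1.1 * g (complexity D q.2) < q.1.2 + 1 := by
      rw [← one_div, div_lt_div_iff₀ (by positivity) (by positivity), one_mul]
      simp only [g]
      exact_mod_cast Iff.rfl
    rw [hq]
    constructor
    · rintro ⟨p, hp, h⟩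
      exact lt_of_le_of_lt (Nat.mul_le_mul_left _ (hmono (complexity_le hp))) h
    · intro h
      obtain ⟨p, hp, hpz⟩ := exists_program hD q.2
      exact ⟨p, hpz, by rwa [hp]⟩

theorem IsAPrioriProbability.one_le_mul_complexity (hD : IsOptimal D)
    (hm : IsAPrioriProbability m) :
    ∃ c : ℝ, 0 < c ∧ ∀ z, 1 ≤ c * ((complexity D z + 1) * (complexity D z + 2)) *
      (m z * 2 ^ complexity D z) := by
  obtain ⟨c, hc, h⟩ := hm.2 _ (isLowerSemicomputableSemimeasure_complexity hD)
  refine ⟨c, hc, fun z => ?_⟩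
  have := h z
  rw [inv_le_iff_one_le_mul₀ (by positivity)] at this
  linarith

end APriori

/-! ### The online marking algorithm with multiplicative weights. -/

section Marking

variable {P I : Type} (inc : P → I → Bool)

/-- The total weight of the points of a weighted list that are incident to `B`. -/
def capture (W : List (P × ℕ)) (B : I) : ℕ :=
  (W.filterMap fun q => bif inc q.1 B then some q.2 else none).sum

/-- The weighted list without the points incident to `B`. -/
def removeIncident (W : List (P × ℕ)) (B : I) : List (P × ℕ) :=
  W.filterMap fun q => bif inc q.1 B then none else some q

/-- The weighted list in which the weights of the points incident to `B` are increased by the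
fraction `1 / E`. -/
def boostIncident (E : ℕ) (W : List (P × ℕ)) (B : I) : List (P × ℕ) :=
  W.map fun q => (q.1, bif inc q.1 B then q.2 + q.2 / E else q.2)

/-- The total weight of a weighted list. -/
def totalWeight (W : List (P × ℕ)) : ℕ := (W.map Prod.snd).sum

/-- The weighted list of uncovered points after the first `t` items have been processed. An item
is marked, and the points incident to it are removed, if these points have large total weight;
otherwise their weights are increased. -/
def weightsAt (E N : ℕ) (U : List P) (item : ℕ → Option I) (t : ℕ) : List (P × ℕ) :=
  Nat.rec (U.map fun p => (p, E)) (fun s W => (item s).elim W fun B =>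
    if U.length * E ^ 2 ≤ N * capture inc W B then removeIncident inc W B
    else boostIncident inc E W B) t

/-- The item `B` arrives at time `t` and is marked. -/
def IsMarkedAt (E N : ℕ) (U : List P) (item : ℕ → Option I) (t : ℕ) (B : I) : Prop :=
  item t = some B ∧ U.length * E ^ 2 ≤ N * capture inc (weightsAt inc E N U item t) B

section Primrec

variable {α : Type} [Primcodable α] [Primcodable P] [Primcodable I] {inc}

theorem primrec_list_sum : Primrec (List.sum : List ℕ → ℕ) := by
  have h : Primrec₂ fun (_ : List ℕ) (q : ℕ × ℕ) => q.1 + q.2 :=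
    Primrec.nat_add.comp (Primrec.fst.comp Primrec.snd) (Primrec.snd.comp Primrec.snd)
  exact Primrec.list_foldr Primrec.id (Primrec.const 0) h

theorem primrec_capture (hinc : Primrec₂ inc) : Primrec₂ (capture inc) := by
  refine primrec_list_sum.comp (Primrec.listFilterMap Primrec.fst ?_)
  exact Primrec.cond (hinc.comp (Primrec.fst.comp Primrec.snd) (Primrec.snd.comp Primrec.fst))
    (Primrec.option_some.comp (Primrec.snd.comp Primrec.snd)) (Primrec.const none)

theorem primrec_removeIncident (hinc : Primrec₂ inc) : Primrec₂ (removeIncident inc) := by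
  refine Primrec.listFilterMap Primrec.fst ?_
  exact Primrec.cond (hinc.comp (Primrec.fst.comp Primrec.snd) (Primrec.snd.comp Primrec.fst))
    (Primrec.const none) (Primrec.option_some.comp Primrec.snd)

theorem primrec_boostIncident (hinc : Primrec₂ inc) :
    Primrec fun q : ℕ × List (P × ℕ) × I => boostIncident inc q.1 q.2.1 q.2.2 := by
  refine Primrec.list_map (Primrec.fst.comp Primrec.snd) ?_
  have hw : Primrec fun v : (ℕ × List (P × ℕ) × I) × (P × ℕ) => v.2.2 :=
    Primrec.snd.comp Primrec.snd
  refine Primrec.pair (Primrec.fst.comp Primrec.snd) (Primrec.cond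
    (hinc.comp (Primrec.fst.comp Primrec.snd) (Primrec.snd.comp (Primrec.snd.comp Primrec.fst)))
    (Primrec.nat_add.comp hw (Primrec.nat_div.comp hw (Primrec.fst.comp Primrec.fst))) hw)

theorem primrec_sq : Primrec fun n : ℕ => n ^ 2 :=
  (Primrec.nat_mul.comp Primrec.id Primrec.id).of_eq fun n => (sq n).symm

theorem primrec_weightsAt (hinc : Primrec₂ inc) {E N : α → ℕ} {U : α → List P}
    {item : α → ℕ → Option I} (hE : Primrec E) (hN : Primrec N) (hU : Primrec U)
    (hitem : Primrec₂ item) :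
    Primrec₂ fun a t => weightsAt inc (E a) (N a) (U a) (item a) t := by
  have h0 : Primrec fun a => (U a).map fun p => (p, E a) :=
    Primrec.list_map hU (Primrec.pair Primrec.snd (hE.comp Primrec.fst))
  have hstep : Primrec₂ fun (a : α) (q : ℕ × List (P × ℕ)) =>
      ((item a q.1).casesOn q.2 fun B =>
        if (U a).length * E a ^ 2 ≤ N a * capture inc q.2 B then removeIncident inc q.2 B
        else boostIncident inc (E a) q.2 B : List (P × ℕ)) := by
    refine Primrec.option_casesOn (hitem.comp Primrec.fst (Primrec.fst.comp Primrec.snd))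
      (Primrec.snd.comp Primrec.snd) ?_
    have ha : Primrec fun v : (α × ℕ × List (P × ℕ)) × I => v.1.1 := Primrec.fst.comp Primrec.fst
    have hW : Primrec fun v : (α × ℕ × List (P × ℕ)) × I => v.1.2.2 :=
      Primrec.snd.comp (Primrec.snd.comp Primrec.fst)
    refine Primrec.ite (Primrec.nat_le.comp ?_ ?_) ?_ ?_
    · exact Primrec.nat_mul.comp (Primrec.list_length.comp (hU.comp ha))
        (primrec_sq.comp (hE.comp ha))
    · exact Primrec.nat_mul.comp (hN.comp ha) ((primrec_capture hinc).comp hW Primrec.snd)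
    · exact (primrec_removeIncident hinc).comp hW Primrec.snd
    · exact (primrec_boostIncident hinc).comp (.pair (hE.comp ha) (.pair hW Primrec.snd))
  refine Primrec.of_eq (Primrec.nat_rec h0 hstep) ?_
  rintro ⟨a, t⟩
  simp only [weightsAt]
  induction t with
  | zero => rfl
  | succ t ih =>
    simp only [ih]
    cases item a t <;> rfl

theorem primrec_isMarkedAt (hinc : Primrec₂ inc) {E N : α → ℕ} {U : α → List P}
    {item : α → ℕ → Option I} (hE : Primrec E) (hN : Primrec N) (hU : Primrec U)
    (hitem : Primrec₂ item) :
    PrimrecPred fun q : (α × ℕ) × I =>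
      IsMarkedAt inc (E q.1.1) (N q.1.1) (U q.1.1) (item q.1.1) q.1.2 q.2 := by
  have ha : Primrec fun q : (α × ℕ) × I => q.1.1 := Primrec.fst.comp Primrec.fst
  have ht : Primrec fun q : (α × ℕ) × I => q.1.2 := Primrec.snd.comp Primrec.fst
  classical
  refine PrimrecPred.and ?_ ?_
  · exact Primrec.eq.comp (hitem.comp ha ht) (Primrec.option_some.comp Primrec.snd)
  · refine Primrec.nat_le.comp ?_ ?_
    · exact Primrec.nat_mul.comp (Primrec.list_length.comp (hU.comp ha))
        (primrec_sq.comp (hE.comp ha))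
    · exact Primrec.nat_mul.comp (hN.comp ha) ((primrec_capture hinc).comp
        ((primrec_weightsAt hinc hE hN hU hitem).comp ha ht) Primrec.snd)

end Primrec

variable {inc}

theorem totalWeight_removeIncident (W : List (P × ℕ)) (B : I) :
    totalWeight (removeIncident inc W B) + capture inc W B = totalWeight W := by
  induction W with
  | nil => rfl
  | cons q W ih =>
    simp only [totalWeight, removeIncident, capture, List.filterMap_cons, List.map_cons,
      List.sum_cons] at ih ⊢
    cases inc q.1 B <;> simp <;> omega

theorem mul_totalWeight_boostIncident_le (E : ℕ) (W : List (P × ℕ)) (B : I) :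
    E * totalWeight (boostIncident inc E W B) ≤ E * totalWeight W + capture inc W B := by
  induction W with
  | nil => simp [boostIncident, totalWeight]
  | cons q W ih =>
    simp only [totalWeight, boostIncident, capture, List.filterMap_cons, List.map_cons,
      List.sum_cons] at ih ⊢
    have h := Nat.mul_div_le q.2 E
    cases inc q.1 B <;> simp only [cond_true, cond_false, List.sum_cons, mul_add] at ih ⊢ <;>
      omega

theorem le_totalWeight {W : List (P × ℕ)} {p : P} {w : ℕ} (h : (p, w) ∈ W) :
    w ≤ totalWeight W :=
  List.single_le_sum (by simp) _ (List.mem_map.2 ⟨(p, w), h, rfl⟩)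

variable {E N : ℕ} {U : List P} {item : ℕ → Option I}

theorem weightsAt_succ (t : ℕ) : weightsAt inc E N U item (t + 1) =
    (item t).elim (weightsAt inc E N U item t) fun B =>
      if U.length * E ^ 2 ≤ N * capture inc (weightsAt inc E N U item t) B then
        removeIncident inc (weightsAt inc E N U item t) B
      else boostIncident inc E (weightsAt inc E N U item t) B := rfl

-- The potential argument, multiplied by `N` to stay in the integers: a mark removes weight at least
-- |U|E²/N, and an unmarked item adds at most a fraction 1/E of a captured weight below |U|E²/N,
-- that is, at most |U|E/N.
open Classical in
theorem totalWeight_weightsAt_le (hE : 0 < E) (t : ℕ) :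
    N * totalWeight (weightsAt inc E N U item t) +
      Nat.count (fun s => ∃ B, IsMarkedAt inc E N U item s B) t * (U.length * E ^ 2) ≤
    N * (U.length * E) + Nat.count (fun s => (item s).isSome) t * (U.length * E) := by
  induction t with
  | zero =>
    have : totalWeight (weightsAt inc E N U item 0) = U.length * E := by
      simp [weightsAt, totalWeight, Function.comp_def]
    simp [this]
  | succ t ih =>
    rw [weightsAt_succ, Nat.count_succ, Nat.count_succ]
    cases hB : item t with
    | none => simpa [IsMarkedAt, hB] using ih
    | some B =>
      simp only [IsMarkedAt, hB, Option.elim_some, Option.some.injEq, Option.isSome_some,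
        if_true, exists_eq_left'] at ih ⊢
      have h1 := totalWeight_removeIncident (inc := inc) (weightsAt inc E N U item t) B
      have h2 := mul_totalWeight_boostIncident_le (inc := inc) E (weightsAt inc E N U item t) B
      split_ifs with h
      · have h3 : N * totalWeight (removeIncident inc (weightsAt inc E N U item t) B) +
            N * capture inc (weightsAt inc E N U item t) B =
            N * totalWeight (weightsAt inc E N U item t) := by rw [← mul_add, h1]
        nlinarith
      · have h3 : N * totalWeight (boostIncident inc E (weightsAt inc E N U item t) B) ≤
            N * totalWeight (weightsAt inc E N U item t) + U.length * E := by
          refine Nat.le_of_mul_le_mul_left (c := E) ?_ hE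
          have h4 := Nat.mul_le_mul_left N h2
          have h5 := not_le.1 h
          nlinarith
        nlinarith

/-- The weight of an uncovered point after it was met by `j` items. -/
def boosted (E : ℕ) : ℕ → ℕ
  | 0 => E
  | j + 1 => boosted E j + boosted E j / E

theorem boosted_mono (E : ℕ) : Monotone (boosted E) :=
  monotone_nat_of_le_succ fun _ => Nat.le_add_right _ _

/-- The weight doubles every `E` boosts in spite of rounding down: once it is at least E·2^i, each
boost adds at least 2^i. Starting from weight `E` ensures that even the first boost is positive. -/
theorem le_boosted (hE : 0 < E) (i : ℕ) : E * 2 ^ i ≤ boosted E (E * i) := by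
  induction i with
  | zero => simp [boosted]
  | succ i ih =>
    have h : ∀ j, E * 2 ^ i + j * 2 ^ i ≤ boosted E (E * i + j) := by
      intro j
      induction j with
      | zero => simpa using ih
      | succ j ihj =>
        have h1 : 2 ^ i ≤ boosted E (E * i + j) / E := by
          rw [Nat.le_div_iff_mul_le hE, mul_comm]
          exact ih.trans (boosted_mono E (Nat.le_add_right _ _))
        change _ ≤ boosted E (E * i + j) + boosted E (E * i + j) / E
        rw [add_mul]
        omega
    have := h E
    rw [mul_add, mul_one, pow_succ]
    linarith

open Classical in
theorem covered_or_mem_weightsAt {p : P} (hp : p ∈ U) (t : ℕ) :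
    (∃ s < t, ∃ B, IsMarkedAt inc E N U item s B ∧ inc p B = true) ∨
      (p, boosted E (Nat.count (fun s => ∃ B, item s = some B ∧ inc p B = true) t)) ∈
        weightsAt inc E N U item t := by
  induction t with
  | zero =>
    right
    simpa [weightsAt, boosted] using hp
  | succ t ih =>
    rcases ih with ⟨s, hs, h⟩ | ih
    · exact Or.inl ⟨s, by omega, h⟩
    rw [weightsAt_succ, Nat.count_succ]
    cases hB : item t with
    | none => right; simpa using ih
    | some B =>
      simp only [Option.elim_some, Option.some.injEq, exists_eq_left']
      by_cases hpB : inc p B = true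
      · split_ifs with h
        · exact Or.inl ⟨t, by omega, B, ⟨hB, h⟩, hpB⟩
        · right
          exact List.mem_map.2 ⟨_, ih, by simp [hpB, boosted]⟩
      · right
        rw [if_neg hpB]
        split_ifs with h
        · exact List.mem_filterMap.2 ⟨_, ih, by simp [hpB]⟩
        · exact List.mem_map.2 ⟨_, ih, by simp [hpB]⟩

-- With at most `N` items the weight ever added is at most |U|E, as much as the initial weight. Each
-- mark uses up |U|E²/N of these 2|U|E, so there are at most 2N/E marks.
open Classical in
theorem mul_count_isMarkedAt_le (hE : 0 < E) (hU : U ≠ [])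
    (hN : ∀ t, Nat.count (fun s => (item s).isSome) t ≤ N) (t : ℕ) :
    E * Nat.count (fun s => ∃ B, IsMarkedAt inc E N U item s B) t ≤ 2 * N := by
  have h := totalWeight_weightsAt_le (inc := inc) (N := N) (U := U) (item := item) hE t
  have hU' : 0 < U.length := List.length_pos_iff.2 hU
  refine Nat.le_of_mul_le_mul_left (c := U.length * E) ?_ (by positivity)
  have h1 := Nat.mul_le_mul_right (U.length * E) (hN t)
  nlinarith

-- An uncovered point met E(τ + 2) times would alone weigh at least 4E·2^τ, whereas the total weight
-- never exceeds 2E|U| ≤ 2E·2^τ.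
open Classical in
theorem exists_isMarkedAt (hE : 0 < E) (hN0 : 0 < N)
    (hN : ∀ t, Nat.count (fun s => (item s).isSome) t ≤ N) {τ : ℕ} (hτ : U.length ≤ 2 ^ τ)
    {p : P} (hp : p ∈ U) {t : ℕ}
    (ht : E * (τ + 2) ≤ Nat.count (fun s => ∃ B, item s = some B ∧ inc p B = true) t) :
    ∃ s < t, ∃ B, IsMarkedAt inc E N U item s B ∧ inc p B = true := by
  refine (covered_or_mem_weightsAt hp t).resolve_right fun hmem => ?_
  have h1 := le_totalWeight hmem
  have h2 := (le_boosted hE (τ + 2)).trans (boosted_mono E ht)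
  have h3 := totalWeight_weightsAt_le (inc := inc) (N := N) (U := U) (item := item) hE t
  have h4 := Nat.mul_le_mul_right (U.length * E) (hN t)
  have h5 : N * totalWeight (weightsAt inc E N U item t) ≤ N * (2 * (U.length * E)) :=
    (Nat.le_add_right _ _).trans (h3.trans (by linarith))
  have h6 := Nat.le_of_mul_le_mul_left h5 hN0
  have h7 := Nat.mul_le_mul_right E hτ
  have h8 : 0 < 2 ^ τ * E := by positivity
  have h9 : E * 2 ^ (τ + 2) = 4 * (2 ^ τ * E) := by rw [pow_add]; ring
  omega

end Marking

theorem primrec_pow : Primrec₂ fun a n : ℕ => a ^ n := by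
  have h : Primrec₂ fun (v : ℕ × ℕ) (q : ℕ × ℕ) => q.2 * v.1 :=
    Primrec.nat_mul.comp (Primrec.snd.comp Primrec.snd) (Primrec.fst.comp Primrec.fst)
  refine Primrec.of_eq (Primrec.nat_rec' Primrec.snd (Primrec.const 1) h) ?_
  rintro ⟨a, n⟩
  simp only
  induction n with
  | zero => rfl
  | succ n ih => simp only [ih, pow_succ]

theorem primrecRel_mem {α : Type} [Primcodable α] :
    PrimrecRel fun (a : α) (L : List α) => a ∈ L := by
  have h : PrimrecRel fun (b a : α) => b = a := Primrec.eq
  exact (h.exists_mem_list.comp Primrec.snd Primrec.fst).of_eq (by simp)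

theorem primrecRel_subset {α : Type} [Primcodable α] :
    PrimrecRel fun (X L : List α) => ∀ a ∈ X, a ∈ L :=
  primrecRel_mem.forall_mem_list

/-! ### Canonical lists representing finite sets. -/

section Canonical

/-- `L` lists a set of strings of length `n` in lexicographical order. -/
def IsCanonical (n : ℕ) (L : List Str) : Prop := (binWords n).filter (fun w => decide (w ∈ L)) = L

theorem primrecRel_isCanonical : PrimrecRel IsCanonical := by
  have h : Primrec₂ fun (W L : List Str) => W.filter (fun w => decide (w ∈ L)) :=
    primrecRel_mem.listFilter
  exact Primrec.eq.comp (h.comp (primrec_binWords.comp Primrec.fst) Primrec.snd) Primrec.snd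

variable {n : ℕ} {L : List Str} {A : Finset Str}

theorem isCanonical_sort (hA : A ⊆ cube n) : IsCanonical n (A.sort (· ≤ ·)) := by
  have h1 : ((binWords n).filter fun w => decide (w ∈ A)).toFinset = A := by
    ext w
    simp only [List.mem_toFinset, List.mem_filter, mem_binWords, decide_eq_true_eq,
      and_iff_right_iff_imp]
    exact fun h => mem_cube.1 (hA h)
  have h2 := (List.toFinset_sort (· ≤ ·) ((nodup_binWords n).filter fun w => decide (w ∈ A))).2
    (((pairwise_lt_binWords n).imp le_of_lt).filter _)
  rw [h1] at h2
  simp only [IsCanonical, Finset.mem_sort]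
  exact h2.symm

theorem IsCanonical.nodup (hL : IsCanonical n L) : L.Nodup := by
  rw [← hL]
  exact (nodup_binWords n).filter _

theorem IsCanonical.toFinset_subset (hL : IsCanonical n L) : L.toFinset ⊆ cube n := by
  intro w hw
  rw [List.mem_toFinset, ← hL, List.mem_filter, mem_binWords] at hw
  exact mem_cube.2 hw.1

theorem IsCanonical.sort_toFinset (hL : IsCanonical n L) : L.toFinset.sort (· ≤ ·) = L := by
  refine (List.toFinset_sort (· ≤ ·) hL.nodup).2 ?_
  rw [← hL]
  exact ((pairwise_lt_binWords n).imp le_of_lt).filter _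

theorem IsCanonical.setCode_toFinset (hL : IsCanonical n L) : setCode L.toFinset = listCode L := by
  rw [setCode, hL.sort_toFinset]

theorem IsCanonical.card_toFinset (hL : IsCanonical n L) : L.toFinset.card = L.length :=
  List.toFinset_card_of_nodup hL.nodup

end Canonical

open Classical in
theorem exists_card_le_count {γ : Type} {Q : ℕ → Prop} {F : Finset γ} (f : γ → ℕ)
    (hf : Set.InjOn f F) (hQ : ∀ z ∈ F, Q (f z)) : ∃ t, F.card ≤ Nat.count Q t := by
  refine ⟨F.sup f + 1, ?_⟩
  rw [Nat.count_eq_card_filter_range]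
  refine Finset.card_le_card_of_injOn f (fun z hz => ?_) hf
  refine Finset.mem_filter.2 ⟨Finset.mem_range.2 ?_, hQ z hz⟩
  exact Nat.lt_succ_of_le (Finset.le_sup hz)

/-! ### Many models imply a simpler model. -/

section Cover

variable {D : Str →. Str} {𝒜 : Set (Finset Str)}

/-- `A` is a member of `𝒜` that consists of strings of length `n` and contains all entries of
`X`. -/
def IsModel (𝒜 : Set (Finset Str)) (n : ℕ) (X : List Str) (A : Finset Str) : Prop :=
  A ∈ 𝒜 ∧ A ⊆ cube n ∧ ∀ w ∈ X, w ∈ A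

/-- The word `X` consists of entries of `L`. -/
def subsetBool (X L : List Str) : Bool := decide (∀ w ∈ X, w ∈ L)

theorem primrec_subsetBool : Primrec₂ subsetBool := primrecRel_subset.decide

theorem rePred_class (hD : IsOptimal D) (h𝒜 : IsDecidableFamily 𝒜) :
    REPred fun q : (ℕ × ℕ × ℕ × ℕ × ℕ) × List Str =>
      ((IsCanonical q.1.1 q.2 ∧ q.2.length ^ q.1.2.1 ≤ 2 ^ q.1.2.2.2.1) ∧ q.2.toFinset ∈ 𝒜) ∧
        ∃ p : Str, p.length ≤ q.1.2.2.1 ∧ listCode q.2 ∈ D p := by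
  have hL : Primrec fun q : (ℕ × ℕ × ℕ × ℕ × ℕ) × List Str => q.2 := Primrec.snd
  have h1 : Primrec fun q : (ℕ × ℕ × ℕ × ℕ × ℕ) × List Str => q.1.2 :=
    Primrec.snd.comp Primrec.fst
  have h2 : Primrec fun q : (ℕ × ℕ × ℕ × ℕ × ℕ) × List Str => q.1.2.2 := Primrec.snd.comp h1
  have h3 : Primrec fun q : (ℕ × ℕ × ℕ × ℕ × ℕ) × List Str => q.1.2.2.2 := Primrec.snd.comp h2
  refine rePred_and (rePred_and (PrimrecPred.computablePred (PrimrecPred.and ?_ ?_)).to_re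
    (rePred_comp h𝒜.to_re Computable.snd)) ?_
  · exact primrecRel_isCanonical.comp (Primrec.fst.comp Primrec.fst) hL
  · exact Primrec.nat_le.comp
      (primrec_pow.comp (Primrec.list_length.comp hL) (Primrec.fst.comp h1))
      (primrec_two_pow.comp (Primrec.fst.comp h3))
  · refine rePred_exists (rePred_and (PrimrecPred.computablePred ?_).to_re ?_)
    · exact Primrec.nat_le.comp (Primrec.list_length.comp Primrec.snd)
        (Primrec.fst.comp (h2.comp Primrec.fst))
    · exact rePred_comp (rePred_mem hD.1)
        (f := fun v : ((ℕ × ℕ × ℕ × ℕ × ℕ) × List Str) × Str => (v.2, listCode v.1.2))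
        (Primrec.pair Primrec.snd (primrec_listCode.comp (hL.comp Primrec.fst))).to_comp

/-- Apply the marking algorithm with tuples as points and the enumerated members of the class (size
bound `u`, complexity bound `k`) as items. The tuple `X` meets at least |S| items, hence a marked
one, and a marked set has a description of k + 2 - e bits plus the parameters. -/
theorem exists_simple_model (hD : IsOptimal D) (h𝒜 : IsDecidableFamily 𝒜) :
    ∃ c : ℕ, ∀ (n l k u : ℕ) (X : List Str), X.length = l + 1 → (∀ w ∈ X, w.length = n) →
      ∀ (S : Finset (Finset Str)), (∀ A ∈ S, IsModel 𝒜 n X A ∧ A.card ^ l ≤ 2 ^ u ∧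
        setComplexity D A ≤ k) →
      ∀ e, 2 ^ e * (n * (l + 1) + 2) ≤ S.card →
      e ≤ k ∧ ∃ A, IsModel 𝒜 n X A ∧ A.card ^ l ≤ 2 ^ u ∧
        2 ^ setComplexity D A * 2 ^ e ≤
          2 ^ c * 2 ^ (k + 2) * (Encodable.encode (n, l, k, u, e) + 1) ^ 2 := by
  classical
  obtain ⟨item, hitem, hR, hinj⟩ := exists_primrec_enumeration
    (R := fun (π : ℕ × ℕ × ℕ × ℕ × ℕ) (L : List Str) =>
      ((IsCanonical π.1 L ∧ L.length ^ π.2.1 ≤ 2 ^ π.2.2.2.1) ∧ L.toFinset ∈ 𝒜) ∧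
        ∃ p : Str, p.length ≤ π.2.2.1 ∧ listCode L ∈ D p) (rePred_class hD h𝒜)
  -- For π = (n, l, k, u, e) the boost parameter is E = 2^e, the bound on the number of items is
  -- 2^(k+1), which counts sets of complexity at most k, and the points are the (l + 1)-tuples of
  -- n-bit strings.
  let Marked : ℕ × ℕ × ℕ × ℕ × ℕ → ℕ → List Str → Prop := fun π =>
    IsMarkedAt subsetBool (2 ^ π.2.2.2.2) (2 ^ (π.2.2.1 + 1)) (words (binWords π.1) (π.2.1 + 1))
      (item π)
  have hMarked : PrimrecPred fun q : ((ℕ × ℕ × ℕ × ℕ × ℕ) × ℕ) × List Str =>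
      Marked q.1.1 q.1.2 q.2 := by
    have h1 : Primrec fun π : ℕ × ℕ × ℕ × ℕ × ℕ => π.2 := Primrec.snd
    have h2 : Primrec fun π : ℕ × ℕ × ℕ × ℕ × ℕ => π.2.2 := Primrec.snd.comp h1
    have h3 : Primrec fun π : ℕ × ℕ × ℕ × ℕ × ℕ => π.2.2.2 := Primrec.snd.comp h2
    exact primrec_isMarkedAt primrec_subsetBool (primrec_two_pow.comp (Primrec.snd.comp h3))
      (primrec_two_pow.comp (Primrec.succ.comp (Primrec.fst.comp h2)))
      (primrec_words.comp (primrec_binWords.comp Primrec.fst)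
        (Primrec.succ.comp (Primrec.fst.comp h1))) hitem
  -- Here s = k + 2 - e is the logarithm of the bound 2 · 2^(k+1) / 2^e on the number of marks; the
  -- additive form avoids truncated subtraction.
  let R : ℕ → ℕ → Str → Prop := fun a s z => ∃ v : ((ℕ × ℕ × ℕ × ℕ × ℕ) × ℕ) × List Str,
    ((a = Encodable.encode v.1.1 ∧ s + v.1.1.2.2.2.2 = v.1.1.2.2.1 + 2) ∧ z = listCode v.2) ∧
      Marked v.1.1 v.1.2 v.2
  obtain ⟨c, hc⟩ := complexity_le_of_enumerable hD (R := R) (by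
    have hv : Primrec fun q : ((ℕ × ℕ) × Str) × (((ℕ × ℕ × ℕ × ℕ × ℕ) × ℕ) × List Str) => q.2 :=
      Primrec.snd
    have hπ : Primrec fun q : ((ℕ × ℕ) × Str) × (((ℕ × ℕ × ℕ × ℕ × ℕ) × ℕ) × List Str) =>
      q.2.1.1 := Primrec.fst.comp (Primrec.fst.comp hv)
    have h2 : Primrec fun q : ((ℕ × ℕ) × Str) × (((ℕ × ℕ × ℕ × ℕ × ℕ) × ℕ) × List Str) =>
      q.2.1.1.2.2 := Primrec.snd.comp (Primrec.snd.comp hπ)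
    refine rePred_exists (PrimrecPred.computablePred
      (PrimrecPred.and (PrimrecPred.and (PrimrecPred.and ?_ ?_) ?_) (hMarked.comp hv))).to_re
    · exact Primrec.eq.comp (Primrec.fst.comp (Primrec.fst.comp Primrec.fst))
        (Primrec.encode.comp hπ)
    · exact Primrec.eq.comp (Primrec.nat_add.comp
        (Primrec.snd.comp (Primrec.fst.comp Primrec.fst)) (Primrec.snd.comp (Primrec.snd.comp h2)))
        (Primrec.nat_add.comp (Primrec.fst.comp h2) (Primrec.const 2))
    · exact Primrec.eq.comp (Primrec.snd.comp Primrec.fst)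
        (primrec_listCode.comp (Primrec.snd.comp hv)))
  refine ⟨c, fun n l k u X hXl hXn S hS e he => ?_⟩
  set π : ℕ × ℕ × ℕ × ℕ × ℕ := (n, l, k, u, e) with hπ
  have hSk : S.card ≤ 2 ^ (k + 1) := by
    rw [← Finset.card_image_of_injective S setCode_injective]
    refine card_le_of_complexity_le hD fun z hz => ?_
    obtain ⟨A, hA, rfl⟩ := Finset.mem_image.1 hz
    exact (hS A hA).2.2
  -- The summand 2 in n(l + 1) + 2 gives 2^(e+1) ≤ |S| ≤ 2^(k+1).
  have hek : e ≤ k := by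
    have h1 : 2 ^ (e + 1) ≤ 2 ^ (k + 1) := by
      rw [pow_succ 2 e]
      exact (Nat.mul_le_mul_left _ (by omega)).trans (he.trans hSk)
    have := (Nat.pow_le_pow_iff_right (by norm_num : 1 < 2)).1 h1
    omega
  have hitem_some : ∀ t L, item π t = some L → ((IsCanonical n L ∧ L.length ^ l ≤ 2 ^ u) ∧
      L.toFinset ∈ 𝒜) ∧ ∃ p : Str, p.length ≤ k ∧ listCode L ∈ D p :=
    fun t L h => (hR π L).2 ⟨t, h⟩
  have hN : ∀ t, Nat.count (fun s => (item π s).isSome) t ≤ 2 ^ (k + 1) := by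
    intro t
    let F : Finset Str := ((List.range t).filterMap (item π)).toFinset.image listCode
    have hF : F.card ≤ 2 ^ (k + 1) := by
      refine card_le_of_complexity_le hD fun z hz => ?_
      simp only [F, Finset.mem_image, List.mem_toFinset, List.mem_filterMap] at hz
      obtain ⟨L, ⟨i, -, hi⟩, rfl⟩ := hz
      obtain ⟨-, p, hp, hpz⟩ := hitem_some i L hi
      exact (complexity_le hpz).trans hp
    refine le_trans ?_ hF
    rw [Nat.count_eq_card_filter_range]
    refine Finset.card_le_card_of_injOn (fun s => listCode ((item π s).getD [])) ?_ ?_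
    · intro s hs
      obtain ⟨hs1, hs2⟩ := Finset.mem_filter.1 hs
      obtain ⟨L, hL⟩ := Option.isSome_iff_exists.1 hs2
      simp only [F, Finset.coe_image, Set.mem_image, Finset.mem_coe, List.mem_toFinset,
        List.mem_filterMap]
      exact ⟨L, ⟨s, List.mem_range.2 (Finset.mem_range.1 hs1), hL⟩, by simp [hL]⟩
    · intro s hs s' hs' h
      obtain ⟨L, hL⟩ := Option.isSome_iff_exists.1 (Finset.mem_filter.1 hs).2
      obtain ⟨L', hL'⟩ := Option.isSome_iff_exists.1 (Finset.mem_filter.1 hs').2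
      simp only [hL, hL', Option.getD_some] at h
      rw [← listCode_injective h] at hL'
      exact hinj _ _ _ _ hL hL'
  have hX : X ∈ words (binWords n) (l + 1) :=
    mem_words.2 ⟨hXl, fun w hw => mem_binWords.2 (hXn w hw)⟩
  have hτ : (words (binWords n) (l + 1)).length ≤ 2 ^ (n * (l + 1)) := by
    rw [length_words, length_binWords, pow_mul]
  have htime : ∀ A ∈ S, ∃ t, item π t = some (A.sort (· ≤ ·)) := by
    intro A hA
    obtain ⟨⟨h1, h2, h3⟩, h4, h5⟩ := hS A hA
    refine (hR π _).1 ⟨⟨⟨isCanonical_sort h2, by simpa [hπ] using h4⟩, by simpa using h1⟩, ?_⟩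
    obtain ⟨p, hp, hpz⟩ := exists_program hD (setCode A)
    exact ⟨p, hp.trans_le h5, hpz⟩
  choose! time htime using htime
  obtain ⟨t, ht⟩ := exists_card_le_count (F := S)
    (Q := fun s => ∃ B, item π s = some B ∧ subsetBool X B = true) time
    (fun A hA A' hA' h => by
      have h1 := htime A hA
      rw [h, htime A' hA'] at h1
      have h2 := congrArg List.toFinset (Option.some.inj h1)
      simpa using h2.symm)
    (fun A hA => ⟨_, htime A hA, by simpa [subsetBool] using (hS A hA).1.2.2⟩)
  obtain ⟨t', -, L, hmark, hXL⟩ := exists_isMarkedAt (inc := subsetBool) (E := 2 ^ e)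
    (by positivity) (by positivity) hN hτ hX (t := t) (he.trans (ht.trans_eq (by congr)))
  obtain ⟨⟨⟨hcan, hlen⟩, hL𝒜⟩, -⟩ := hitem_some t' L hmark.1
  refine ⟨hek, L.toFinset, ⟨hL𝒜, hcan.toFinset_subset, ?_⟩, ?_, ?_⟩
  · simpa [subsetBool] using hXL
  · rwa [hcan.card_toFinset]
  have hfin := hc (Encodable.encode π) (k + 2 - e) (listCode L) ?_
    ⟨((π, t'), L), ⟨⟨rfl, by simp only [hπ]; omega⟩, rfl⟩, hmark⟩
  · rw [setComplexity, hcan.setCode_toFinset]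
    calc 2 ^ complexity D (listCode L) * 2 ^ e
        ≤ 2 ^ c * 2 ^ (k + 2 - e) * (Encodable.encode π + 1) ^ 2 * 2 ^ e :=
          Nat.mul_le_mul_right _ hfin
      _ = 2 ^ c * (2 ^ (k + 2 - e) * 2 ^ e) * (Encodable.encode π + 1) ^ 2 := by ring
      _ = _ := by rw [← pow_add]; congr 3; omega
  · intro F hF
    have hF' : ∀ z ∈ F, ∃ q : ℕ × List Str, z = listCode q.2 ∧ Marked π q.1 q.2 := by
      intro z hz
      obtain ⟨⟨⟨π', s⟩, B⟩, ⟨⟨h1, -⟩, h2⟩, h3⟩ := hF z hz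
      have h4 : π = π' := Encodable.encode_injective h1
      subst h4
      exact ⟨(s, B), h2, h3⟩
    choose! q hq hqm using hF'
    obtain ⟨t, ht⟩ := exists_card_le_count (F := F) (Q := fun s => ∃ B, Marked π s B)
      (fun z => (q z).1)
      (fun z hz z' hz' h => by
        have h1 := (hqm z hz).1
        have h2 := (hqm z' hz').1
        simp only at h
        rw [h, h2] at h1
        rw [hq z hz, hq z' hz', Option.some.inj h1])
      (fun z hz => ⟨_, hqm z hz⟩)
    have hcount := mul_count_isMarkedAt_le (inc := subsetBool) (E := 2 ^ e) (by positivity)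
      (List.ne_nil_of_mem hX) hN t
    have h1 : 2 ^ e * F.card ≤ 2 ^ e * 2 ^ (k + 2 - e) := by
      refine (Nat.mul_le_mul_left _ ht).trans (hcount.trans (le_of_eq ?_))
      rw [← pow_add, ← pow_succ']
      congr 1
      omega
    exact Nat.le_of_mul_le_mul_left h1 (by positivity)

end Cover

/-! ### Replacing a complex model by a shortest one. -/

theorem flatten_injective_of_length {a : ℕ} {X Y : List Str} (hX : ∀ w ∈ X, w.length = a)
    (hY : ∀ w ∈ Y, w.length = a) (hl : X.length = Y.length) (h : X.flatten = Y.flatten) :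
    X = Y := by
  induction X generalizing Y with
  | nil => exact (List.length_eq_zero_iff.1 hl.symm).symm
  | cons x X ih =>
    cases Y with
    | nil => simp at hl
    | cons y Y =>
      simp only [List.flatten_cons] at h
      have hxy : x.length = y.length := by rw [hX x (by simp), hY y (by simp)]
      obtain ⟨rfl, h2⟩ := List.append_inj h hxy
      rw [ih (fun w hw => hX w (by simp [hw])) (fun w hw => hY w (by simp [hw]))
        (by simpa using hl) h2]

theorem length_flatten_of_length {a : ℕ} {X : List Str} (hX : ∀ w ∈ X, w.length = a) :
    X.flatten.length = X.length * a := by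
  induction X with
  | nil => simp
  | cons x X ih =>
    rw [List.flatten_cons, List.length_append, ih fun w hw => hX w (by simp [hw]),
      hX x (by simp), List.length_cons]
    ring

theorem primrec_sublists' {α : Type} [Primcodable α] :
    Primrec (List.sublists' : List α → List (List α)) := by
  have h : Primrec₂ fun (_ : List α) (q : α × List (List α)) => q.2 ++ q.2.map (List.cons q.1) := by
    have hq : Primrec fun v : List α × (α × List (List α)) => v.2.2 :=
      Primrec.snd.comp Primrec.snd
    exact Primrec.list_append.comp hq (Primrec.list_map hq
      (Primrec.list_cons.comp (Primrec.fst.comp (Primrec.snd.comp Primrec.fst)) Primrec.snd))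
  refine (Primrec.list_foldr Primrec.id (Primrec.const [[]]) h).of_eq fun L => ?_
  induction L with
  | nil => rfl
  | cons a L ih => simp only [id, List.foldr_cons, List.sublists'_cons] at ih ⊢; rw [ih]

/-- Membership in the family is only computable, not primitive recursive, so the filter is built by
a computable recursion along the list. -/
theorem exists_computable_filter {β : Type} [Primcodable β] {P : β → Prop}
    (hP : ComputablePred P) :
    ∃ g : List β → List β, Computable g ∧ ∀ L b, b ∈ g L ↔ b ∈ L ∧ P b := by
  obtain ⟨_, hP⟩ := hP
  let step : List β → ℕ × List β → List β := fun L q =>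
    L[q.1]?.casesOn q.2 fun b => bif decide (P b) then b :: q.2 else q.2
  have hstep : Computable₂ step := by
    have hq : Computable fun v : List β × (ℕ × List β) => v.2.2 :=
      Computable.snd.comp Computable.snd
    refine Computable.option_casesOn (Computable.list_getElem?.comp Computable.fst
      (Computable.fst.comp Computable.snd)) hq ?_
    exact Computable.cond (hP.comp Computable.snd)
      (Computable.list_cons.comp Computable.snd (hq.comp Computable.fst)) (hq.comp Computable.fst)
  refine ⟨_, Computable.nat_rec Computable.list_length (Computable.const []) hstep, fun L b => ?_⟩
  have key : ∀ n, b ∈ (Nat.rec [] (fun i acc => step L (i, acc)) n : List β) ↔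
      ∃ i < n, L[i]? = some b ∧ P b := by
    intro n
    induction n with
    | zero => simp
    | succ n ih =>
      simp only [step] at ih ⊢
      have hsplit : (∃ i < n + 1, L[i]? = some b ∧ P b) ↔
          (∃ i < n, L[i]? = some b ∧ P b) ∨ (L[n]? = some b ∧ P b) := by
        constructor
        · rintro ⟨i, hi, h⟩
          rcases Nat.lt_succ_iff_lt_or_eq.1 hi with hi | rfl
          · exact Or.inl ⟨i, hi, h⟩
          · exact Or.inr h
        · rintro (⟨i, hi, h⟩ | h)
          · exact ⟨i, by omega, h⟩
          · exact ⟨n, by omega, h⟩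
      rw [hsplit, ← ih]
      cases hn : L[n]? with
      | none => simp
      | some b' =>
        by_cases hb : P b'
        · simp only [hb, decide_true, cond_true, List.mem_cons, Option.some.injEq]
          constructor
          · rintro (rfl | h)
            · exact Or.inr ⟨rfl, hb⟩
            · exact Or.inl h
          · rintro (h | ⟨rfl, -⟩)
            · exact Or.inr h
            · exact Or.inl rfl
        · simp only [hb, decide_false, cond_false, Option.some.injEq]
          constructor
          · exact Or.inl
          · rintro (h | ⟨rfl, h⟩)
            · exact h
            · exact absurd h hb
  refine (key _).trans ⟨?_, ?_⟩
  · rintro ⟨i, -, h, hb⟩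
    exact ⟨List.mem_of_getElem? h, hb⟩
  · rintro ⟨h, hb⟩
    obtain ⟨i, hi, h⟩ := List.getElem_of_mem h
    exact ⟨i, hi, by rw [List.getElem?_eq_getElem hi, h], hb⟩

section SmallModel

variable {D : Str →. Str} {𝒜 : Set (Finset Str)}

theorem exists_computable_models (h𝒜 : IsDecidableFamily 𝒜) :
    ∃ M : ℕ → List (List Str), Computable M ∧
      ∀ n L, L ∈ M n ↔ IsCanonical n L ∧ L.toFinset ∈ 𝒜 := by
  classical
  obtain ⟨g, hg, hgmem⟩ := exists_computable_filter h𝒜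
  have hcan : PrimrecRel fun (L : List Str) n => IsCanonical n L :=
    primrecRel_isCanonical.comp Primrec.snd Primrec.fst
  refine ⟨fun n => g ((binWords n).sublists'.filter fun L => decide (IsCanonical n L)),
    hg.comp (Primrec.to_comp ?_), fun n L => ?_⟩
  · exact hcan.listFilter.comp (primrec_sublists'.comp primrec_binWords) Primrec.id
  · rw [hgmem, List.mem_filter, List.mem_sublists', decide_eq_true_eq]
    refine and_congr_left fun _ => and_iff_right_of_imp fun h => ?_
    conv_lhs => rw [← h]
    exact List.filter_sublist

/-- `L` is the first among the shortest lists in `M` that contain all entries of `X`. -/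
def IsShortest (M : List (List Str)) (X L : List Str) : Prop :=
  (L ∈ M ∧ ∀ w ∈ X, w ∈ L) ∧ ∀ L' ∈ M, ¬ (∀ w ∈ X, w ∈ L') ∨ L.length < L'.length ∨
    (L.length = L'.length ∧ Encodable.encode L ≤ Encodable.encode L')

theorem primrec_isShortest :
    PrimrecPred fun q : List (List Str) × List Str × List Str => IsShortest q.1 q.2.1 q.2.2 := by
  have hX : Primrec fun q : List (List Str) × List Str × List Str => q.2.1 :=
    Primrec.fst.comp Primrec.snd
  have hL : Primrec fun q : List (List Str) × List Str × List Str => q.2.2 :=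
    Primrec.snd.comp Primrec.snd
  refine PrimrecPred.and (PrimrecPred.and ?_ ?_) ?_
  · exact primrecRel_mem.comp hL Primrec.fst
  · exact primrecRel_subset.comp hX hL
  · have h : PrimrecRel fun (L' : List Str) (v : List Str × List Str) =>
        ¬ (∀ w ∈ v.1, w ∈ L') ∨ v.2.length < L'.length ∨
          (v.2.length = L'.length ∧ Encodable.encode v.2 ≤ Encodable.encode L') := by
      have hl' : Primrec fun q : List Str × List Str × List Str => q.1.length :=
        Primrec.list_length.comp Primrec.fst
      have hl : Primrec fun q : List Str × List Str × List Str => q.2.2.length :=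
        Primrec.list_length.comp (Primrec.snd.comp Primrec.snd)
      refine PrimrecPred.or (PrimrecPred.not ?_) (PrimrecPred.or (Primrec.nat_lt.comp hl hl')
        (PrimrecPred.and (Primrec.eq.comp hl hl') (Primrec.nat_le.comp ?_ ?_)))
      · exact primrecRel_subset.comp (Primrec.fst.comp Primrec.snd) Primrec.fst
      · exact Primrec.encode.comp (Primrec.snd.comp Primrec.snd)
      · exact Primrec.encode.comp Primrec.fst
    exact h.forall_mem_list.comp Primrec.fst Primrec.snd

theorem IsShortest.unique {M : List (List Str)} {X L L' : List Str} (h : IsShortest M X L)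
    (h' : IsShortest M X L') : L = L' := by
  have h1 := (h.2 L' h'.1.1).resolve_left (not_not.2 h'.1.2)
  have h2 := (h'.2 L h.1.1).resolve_left (not_not.2 h.1.2)
  exact Encodable.encode_injective (by omega)

theorem exists_isShortest {M : List (List Str)} {X L : List Str} (hL : L ∈ M)
    (hX : ∀ w ∈ X, w ∈ L) : ∃ L', IsShortest M X L' ∧ L'.length ≤ L.length := by
  classical
  obtain ⟨L', hL', hmin⟩ := Finset.exists_min_image (M.toFinset.filter fun L => ∀ w ∈ X, w ∈ L)
    (fun L => toLex (L.length, Encodable.encode L)) ⟨L, by simpa using ⟨hL, hX⟩⟩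
  simp only [Finset.mem_filter, List.mem_toFinset, Prod.Lex.le_iff, ofLex_toLex] at hL' hmin
  refine ⟨L', ⟨hL', fun L'' h => ?_⟩, ?_⟩
  · by_cases hX' : ∀ w ∈ X, w ∈ L''
    · exact Or.inr (hmin L'' ⟨h, hX'⟩)
    · exact Or.inl hX'
  · rcases hmin L ⟨hL, hX⟩ with h | h
    · exact h.le
    · exact h.1.le

/-- The first shortest member of the family containing `X` is computed from `n` and the
concatenation of the entries of `X`, which has |X|·n bits. -/
theorem exists_smallest_model (hD : IsOptimal D) (h𝒜 : IsDecidableFamily 𝒜) :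
    ∃ c : ℕ, ∀ (n : ℕ) (X : List Str) (A : Finset Str), 1 ≤ n → (∀ w ∈ X, w.length = n) →
      IsModel 𝒜 n X A → ∃ A', IsModel 𝒜 n X A' ∧ A'.card ≤ A.card ∧
        2 ^ setComplexity D A' ≤ 2 ^ c * 2 ^ (X.length * n) * (n + 1) ^ 2 := by
  obtain ⟨M, hM, hMmem⟩ := exists_computable_models h𝒜
  obtain ⟨c, hc⟩ := complexity_le_of_enumerable hD
    (R := fun a s z => ∃ v : List Str × List Str,
      ((v.1.length * a = s ∧ ∀ w ∈ v.1, w.length = a) ∧ z = listCode v.2) ∧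
        IsShortest (M a) v.1 v.2) (by
    have hX : Primrec fun q : ((ℕ × ℕ) × Str) × (List Str × List Str) => q.2.1 :=
      Primrec.fst.comp Primrec.snd
    have ha : Primrec fun q : ((ℕ × ℕ) × Str) × (List Str × List Str) => q.1.1.1 :=
      Primrec.fst.comp (Primrec.fst.comp Primrec.fst)
    refine rePred_exists (rePred_and (PrimrecPred.computablePred
      (PrimrecPred.and (PrimrecPred.and ?_ ?_) ?_)).to_re (rePred_comp
      (primrec_isShortest.computablePred).to_re
      (f := fun q : ((ℕ × ℕ) × Str) × (List Str × List Str) => (M q.1.1.1, q.2)) ?_))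
    · exact Primrec.eq.comp (Primrec.nat_mul.comp (Primrec.list_length.comp hX) ha)
        (Primrec.snd.comp (Primrec.fst.comp Primrec.fst))
    · have h : PrimrecRel fun (w : Str) (a : ℕ) => w.length = a :=
        Primrec.eq.comp (Primrec.list_length.comp Primrec.fst) Primrec.snd
      exact h.forall_mem_list.comp hX ha
    · exact Primrec.eq.comp (Primrec.snd.comp Primrec.fst)
        (primrec_listCode.comp (Primrec.snd.comp Primrec.snd))
    · exact (hM.comp ha.to_comp).pair Computable.snd)
  refine ⟨c, fun n X A hn hX hA => ?_⟩
  obtain ⟨L, hL, hlen⟩ := exists_isShortest (M := M n) (X := X) (L := A.sort (· ≤ ·))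
    ((hMmem _ _).2 ⟨isCanonical_sort hA.2.1, by simpa using hA.1⟩)
    (fun w hw => by simpa using hA.2.2 w hw)
  obtain ⟨hcan, hL𝒜⟩ := (hMmem n L).1 hL.1.1
  refine ⟨L.toFinset, ⟨hL𝒜, hcan.toFinset_subset, fun w hw => by simpa using hL.1.2 w hw⟩, ?_, ?_⟩
  · rw [hcan.card_toFinset]
    simpa using hlen
  · rw [setComplexity, hcan.setCode_toFinset]
    refine hc n (X.length * n) (listCode L) (fun F hF => ?_) ⟨(X, L), ⟨⟨rfl, hX⟩, rfl⟩, hL⟩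
    choose! v hv using hF
    -- For n ≥ 1 the length of the concatenation determines the number of entries, so the
    -- concatenation determines the tuple and with it its shortest model.
    have hinj : Set.InjOn (fun z => (v z).1.flatten) F := by
      intro z hz z' hz' h
      obtain ⟨⟨⟨h1, h2⟩, h3⟩, h4⟩ := hv z hz
      obtain ⟨⟨⟨h1', h2'⟩, h3'⟩, h4'⟩ := hv z' hz'
      have h5 : (v z).1 = (v z').1 := flatten_injective_of_length h2 h2'
        (Nat.eq_of_mul_eq_mul_right hn (h1.trans h1'.symm)) h
      rw [h5] at h4
      rw [h3, h3', h4.unique h4']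
    rw [← Finset.card_image_of_injOn hinj]
    refine card_le_two_pow_of_length fun q hq => ?_
    obtain ⟨z, hz, rfl⟩ := Finset.mem_image.1 hq
    obtain ⟨⟨⟨h1, h2⟩, -⟩, -⟩ := hv z hz
    rw [length_flatten_of_length h2, h1]

theorem exists_setComplexity_bound (D : Str →. Str) (n₀ : ℕ) :
    ∃ K, ∀ n < n₀, ∀ A ⊆ cube n, setComplexity D A ≤ K := by
  refine ⟨(Finset.range n₀).sup fun n => (cube n).powerset.sup (setComplexity D), ?_⟩
  intro n hn A hA
  exact (Finset.le_sup (f := setComplexity D) (Finset.mem_powerset.2 hA)).trans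
    (Finset.le_sup (f := fun n => (cube n).powerset.sup (setComplexity D))
      (Finset.mem_range.2 hn))

theorem exists_forall_two_pow_mul_sq_le (c : ℕ) :
    ∃ n₀, ∀ n ≥ n₀, 2 ^ c * (n + 1) ^ 2 ≤ 2 ^ (2 * n) := by
  refine ⟨2 * c + 20, fun n hn => ?_⟩
  have h : ∀ n, (n + 1) ^ 2 ≤ 4 * 2 ^ n := by
    intro n
    induction n with
    | zero => norm_num
    | succ n ih =>
      rcases Nat.lt_or_ge n 2 with h | h
      · interval_cases n <;> norm_num
      · rw [pow_succ 2 n]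
        nlinarith
  calc 2 ^ c * (n + 1) ^ 2 ≤ 2 ^ c * (2 ^ 2 * 2 ^ n) := Nat.mul_le_mul_left _ (h n)
    _ = 2 ^ (c + 2 + n) := by rw [pow_add, pow_add]; ring
    _ ≤ 2 ^ (2 * n) := Nat.pow_le_pow_right (by norm_num) (by omega)

/-- Models that are too complex can be replaced by models of bounded complexity. -/
theorem exists_model_of_bounded_complexity (hD : IsOptimal D) (h𝒜 : IsDecidableFamily 𝒜) :
    ∃ N : ℕ, ∀ (n l : ℕ) (X : List Str) (A : Finset Str), 1 ≤ n → N ≤ n + l →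
      X.length = l + 1 → (∀ w ∈ X, w.length = n) → IsModel 𝒜 n X A →
      ∃ A', IsModel 𝒜 n X A' ∧ A'.card ≤ A.card ∧ setComplexity D A' ≤ (l + 3) * n := by
  obtain ⟨c, hc⟩ := exists_smallest_model hD h𝒜
  obtain ⟨n₀, hn₀⟩ := exists_forall_two_pow_mul_sq_le c
  obtain ⟨K, hK⟩ := exists_setComplexity_bound D n₀
  -- For n < n₀ the complexities are at most the constant `K`, and n + l ≥ n₀ + K forces l ≥ K. For
  -- n ≥ n₀ the overhead 2^c(n + 1)² fits into the 2n spare bits between (l + 1)n and (l + 3)n.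
  refine ⟨n₀ + K, fun n l X A hn hN hXl hX hA => ?_⟩
  rcases Nat.lt_or_ge n n₀ with h | h
  · refine ⟨A, hA, le_rfl, (hK n h A hA.2.1).trans ?_⟩
    calc K ≤ l := by omega
      _ ≤ (l + 3) * 1 := by omega
      _ ≤ (l + 3) * n := Nat.mul_le_mul_left _ hn
  · obtain ⟨A', hA', hcard, hA'C⟩ := hc n X A hn hX hA
    refine ⟨A', hA', hcard, (Nat.pow_le_pow_iff_right (by norm_num : 1 < 2)).1 ?_⟩
    calc 2 ^ setComplexity D A' ≤ 2 ^ c * 2 ^ (X.length * n) * (n + 1) ^ 2 := hA'C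
      _ = 2 ^ ((l + 1) * n) * (2 ^ c * (n + 1) ^ 2) := by rw [hXl]; ring
      _ ≤ 2 ^ ((l + 1) * n) * 2 ^ (2 * n) := Nat.mul_le_mul_left _ (hn₀ n h)
      _ = 2 ^ ((l + 3) * n) := by rw [← pow_add]; congr 1; ring

end SmallModel

/-! ### Sums of inverse costs. -/

theorem encode_pair_lt {α β : Type} [Encodable α] [Encodable β] {a : α} {b : β} {B : ℕ}
    (ha : Encodable.encode a < B) (hb : Encodable.encode b < B) :
    Encodable.encode (a, b) < B ^ 2 := by
  rw [Encodable.encode_prod_val]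
  exact (Nat.pair_lt_max_add_one_sq _ _).trans_le (Nat.pow_le_pow_left (max_lt ha hb) 2)

/-- Keeps the cost of the parameters logarithmic: each of the four nested pairings squares the
bound. -/
theorem encode_quintuple_lt {n l k u e B : ℕ} (hn : n < B) (hl : l < B) (hk : k < B) (hu : u < B)
    (he : e < B) : Encodable.encode (n, l, k, u, e) < B ^ 16 := by
  have hpow : ∀ {i x : ℕ}, x < B → i ≠ 0 → x < B ^ i := fun h hi =>
    h.trans_le (Nat.le_self_pow hi B)
  have h1 : Encodable.encode (u, e) < B ^ 2 := encode_pair_lt hu he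
  have h2 : Encodable.encode (k, u, e) < B ^ 4 := by
    have := encode_pair_lt (a := k) (b := (u, e)) (B := B ^ 2) (hpow hk (by norm_num)) h1
    rwa [← pow_mul] at this
  have h3 : Encodable.encode (l, k, u, e) < B ^ 8 := by
    have := encode_pair_lt (a := l) (b := (k, u, e)) (B := B ^ 4) (hpow hl (by norm_num)) h2
    rwa [← pow_mul] at this
  have := encode_pair_lt (a := n) (b := (l, k, u, e)) (B := B ^ 8) (hpow hn (by norm_num)) h3
  rwa [← pow_mul] at this

section Cost

variable {D : Str →. Str} {𝒜 : Set (Finset Str)}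

/-- The number `2 ^ C(A) * |A| ^ l`. -/
noncomputable def cost (D : Str →. Str) (l : ℕ) (A : Finset Str) : ℕ := 2 ^ setComplexity D A * A.card ^ l

theorem exists_min_cost (D : Str →. Str) (l : ℕ) {n : ℕ} {X : List Str} {A : Finset Str}
    (hA : IsModel 𝒜 n X A) :
    ∃ A', IsModel 𝒜 n X A' ∧ ∀ B, IsModel 𝒜 n X B → cost D l A' ≤ cost D l B := by
  classical
  obtain ⟨A', hA', hmin⟩ := Finset.exists_min_image
    ((cube n).powerset.filter fun A => IsModel 𝒜 n X A) (cost D l)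
    ⟨A, by simpa using ⟨hA.2.1, hA⟩⟩
  simp only [Finset.mem_filter, Finset.mem_powerset] at hA' hmin
  exact ⟨A', hA'.2, fun B hB => hmin B ⟨hB.2.1, hB⟩⟩

/-- Choose e with |S| ≈ 2^e · (n(l + 1) + 2); the simpler model then has cost about 2^(k+u-e) up to
polynomial factors, and this bounds the minimum. When |S| is below n(l + 1) + 2, any member of `S`,
of cost at most 2^(k+u), is enough. -/
theorem card_mul_min_cost_le (hD : IsOptimal D) (h𝒜 : IsDecidableFamily 𝒜) :
    ∃ c : ℕ, ∀ (n l k u : ℕ) (X : List Str), X.length = l + 1 → (∀ w ∈ X, w.length = n) →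
      ∀ (S : Finset (Finset Str)), (∀ A ∈ S, IsModel 𝒜 n X A ∧ A.card ^ l ≤ 2 ^ u ∧
        setComplexity D A ≤ k) →
      ∀ A₀, (∀ B, IsModel 𝒜 n X B → cost D l A₀ ≤ cost D l B) →
      ∀ B, n < B → l < B → k < B → u < B →
      S.card * cost D l A₀ ≤ 2 ^ c * (n * (l + 1) + 2) * B ^ 32 * 2 ^ (k + u) := by
  obtain ⟨c, hc⟩ := exists_simple_model hD h𝒜
  refine ⟨c + 3, fun n l k u X hXl hX S hS A₀ hA₀ B hn hl hk hu => ?_⟩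
  set τ := n * (l + 1) + 2
  have hB : 0 < B := by omega
  rcases Nat.lt_or_ge S.card τ with hlt | hge
  · rcases S.eq_empty_or_nonempty with rfl | ⟨A, hA⟩
    · simp
    · obtain ⟨h1, h2, h3⟩ := hS A hA
      have h4 : cost D l A₀ ≤ 2 ^ (k + u) := by
        refine (hA₀ A h1).trans ?_
        rw [pow_add]
        exact Nat.mul_le_mul (Nat.pow_le_pow_right (by norm_num) h3) h2
      refine Nat.mul_le_mul (hlt.le.trans ?_) h4
      calc τ = 1 * τ * 1 := by ring
        _ ≤ 2 ^ (c + 3) * τ * B ^ 32 :=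
          Nat.mul_le_mul (Nat.mul_le_mul_right _ Nat.one_le_two_pow) (Nat.one_le_pow _ _ hB)
  · have hτ : 0 < τ := by omega
    have hq : S.card / τ ≠ 0 := (Nat.div_pos hge hτ).ne'
    set e := Nat.log 2 (S.card / τ)
    have he1 : 2 ^ e * τ ≤ S.card := by
      rw [← Nat.le_div_iff_mul_le hτ]
      exact Nat.pow_log_le_self 2 hq
    have he2 : S.card ≤ 2 ^ (e + 1) * τ := by
      have : S.card / τ < 2 ^ (e + 1) := Nat.lt_pow_succ_log_self (by norm_num) _
      exact ((Nat.div_lt_iff_lt_mul hτ).1 this).le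
    obtain ⟨hek, A, hA, hAu, hAC⟩ := hc n l k u X hXl hX S hS e he1
    have henc := encode_quintuple_lt hn hl hk hu (hek.trans_lt hk)
    calc S.card * cost D l A₀ ≤ (2 ^ (e + 1) * τ) * (2 ^ setComplexity D A * 2 ^ u) :=
          Nat.mul_le_mul he2 ((hA₀ A hA).trans (Nat.mul_le_mul_left _ hAu))
      _ = 2 * τ * 2 ^ u * (2 ^ setComplexity D A * 2 ^ e) := by ring
      _ ≤ 2 * τ * 2 ^ u * (2 ^ c * 2 ^ (k + 2) * (Encodable.encode (n, l, k, u, e) + 1) ^ 2) :=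
          Nat.mul_le_mul_left _ hAC
      _ ≤ 2 * τ * 2 ^ u * (2 ^ c * 2 ^ (k + 2) * (B ^ 16) ^ 2) :=
          Nat.mul_le_mul_left _ (Nat.mul_le_mul_left _ (Nat.pow_le_pow_left henc 2))
      _ = 2 ^ (c + 3) * τ * B ^ 32 * 2 ^ (k + u) := by ring

theorem cost_pos {l n : ℕ} {X : List Str} {A : Finset Str} (hX : X ≠ [])
    (hA : IsModel 𝒜 n X A) : 0 < cost D l A := by
  obtain ⟨w, hw⟩ := List.exists_mem_of_ne_nil X hX
  have : 0 < A.card := Finset.card_pos.2 ⟨w, hA.2.2 w hw⟩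
  unfold cost
  positivity

/-- Split the models by k = C(A) and u = ⌈log₂ |A|^l⌉. There are polynomially many classes, the
costs in one class agree with 2^(k+u) up to a factor 2, and `card_mul_min_cost_le` bounds the size
of each class. -/
theorem sum_inv_cost_le (hD : IsOptimal D) (h𝒜 : IsDecidableFamily 𝒜) :
    ∃ c : ℕ, ∀ (n l : ℕ) (X : List Str), 1 ≤ n → 1 ≤ l → X.length = l + 1 →
      (∀ w ∈ X, w.length = n) →
      ∀ (S : Finset (Finset Str)), (∀ A ∈ S, IsModel 𝒜 n X A ∧
        setComplexity D A ≤ (l + 3) * n) →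
      ∀ A₀, IsModel 𝒜 n X A₀ → (∀ B, IsModel 𝒜 n X B → cost D l A₀ ≤ cost D l B) →
      ∑ A ∈ S, ((cost D l A : ℝ))⁻¹ ≤ ((n : ℝ) + l) ^ c * (cost D l A₀ : ℝ)⁻¹ := by
  obtain ⟨c, hc⟩ := card_mul_min_cost_le hD h𝒜
  -- With s = n + l ≥ 2: c + 1 absorbs 2^(c+1), 4 bounds n(l + 1) + 2, 128 is the exponent of B^32
  -- for B = s^4, and 8 bounds the number of classes.
  refine ⟨c + 1 + 4 + 128 + 8, fun n l X hn hl hXl hX S hS A₀ hA₀ hmin => ?_⟩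
  have hXne : X ≠ [] := by
    rintro rfl
    simp at hXl
  have hpos : ∀ A, IsModel 𝒜 n X A → (0 : ℝ) < cost D l A := fun A hA => by
    exact_mod_cast cost_pos hXne hA
  set s := n + l with hs
  have hs2 : 2 ≤ s := by omega
  have hnl : n * l ≤ s ^ 2 := by
    rw [sq]; exact Nat.mul_le_mul (by omega) (by omega)
  have hss : 2 * s ≤ s ^ 2 := by nlinarith
  have hs24 : 4 * s ^ 2 ≤ s ^ 4 := by nlinarith
  set K := (l + 3) * n with hK
  have hKs : K + 1 ≤ s ^ 4 := by nlinarith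
  have hUs : n * l + 1 ≤ s ^ 4 := by nlinarith
  have hτs : n * (l + 1) + 2 ≤ s ^ 4 := by nlinarith
  let κ : Finset Str → ℕ × ℕ := fun A => (setComplexity D A, Nat.clog 2 (A.card ^ l))
  have hκ : ∀ A ∈ S, κ A ∈ Finset.range (K + 1) ×ˢ Finset.range (n * l + 1) := by
    intro A hA
    refine Finset.mem_product.2 ⟨Finset.mem_range.2 (Nat.lt_succ_of_le (hS A hA).2),
      Finset.mem_range.2 (Nat.lt_succ_of_le (Nat.clog_le_of_le_pow ?_))⟩
    rw [pow_mul]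
    refine Nat.pow_le_pow_left (card_le_two_pow_of_length fun w hw => ?_) l
    exact mem_cube.1 ((hS A hA).1.2.1 hw)
  have hfib : ∀ q ∈ Finset.range (K + 1) ×ˢ Finset.range (n * l + 1),
      ∑ A ∈ S with κ A = q, ((cost D l A : ℝ))⁻¹ ≤
        ((2 ^ (c + 1) * s ^ 4 * (s ^ 4) ^ 32 : ℕ) : ℝ) * (cost D l A₀ : ℝ)⁻¹ := by
    rintro ⟨k, u⟩ hq
    obtain ⟨hk, hu⟩ := Finset.mem_product.1 hq
    rw [Finset.mem_range] at hk hu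
    set F := S.filter fun A => κ A = (k, u)
    have hF : ∀ A ∈ F, A ∈ S ∧ setComplexity D A = k ∧ Nat.clog 2 (A.card ^ l) = u := by
      intro A hA
      obtain ⟨h1, h2⟩ := Finset.mem_filter.1 hA
      exact ⟨h1, congrArg Prod.fst h2, congrArg Prod.snd h2⟩
    have hcard := hc n l k u X hXl hX F (fun A hA => by
      obtain ⟨h1, h2, h3⟩ := hF A hA
      refine ⟨(hS A h1).1, ?_, h2.le⟩
      rw [← h3]
      exact Nat.le_pow_clog (by norm_num) _) A₀ hmin (s ^ 4) (by nlinarith) (by nlinarith)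
      (by simp only at hk; omega) (by simp only at hu; omega)
    have hterm : ∀ A ∈ F, ((cost D l A : ℝ))⁻¹ ≤ 2 * ((2 : ℝ) ^ (k + u))⁻¹ := by
      intro A hA
      obtain ⟨h1, h2, h3⟩ := hF A hA
      have hApos := hpos A (hS A h1).1
      have hcl : 2 ^ u ≤ 2 * A.card ^ l := by
        have hA1 : 0 < A.card ^ l := by
          have h0 : 0 < cost D l A := by exact_mod_cast hApos
          exact Nat.pos_of_mul_pos_left h0
        rcases Nat.lt_or_ge 1 (A.card ^ l) with h | h
        · have := Nat.pow_pred_clog_lt_self (b := 2) (by norm_num) h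
          rw [h3] at this
          rcases u with _ | u
          · omega
          · rw [pow_succ]
            simp only [Nat.pred_succ] at this
            omega
        · have : A.card ^ l = 1 := by omega
          rw [this, Nat.clog_one_right] at h3
          rw [← h3]
          omega
      have h4 : 2 ^ (k + u) ≤ 2 * cost D l A := by
        rw [cost, h2, pow_add]
        nlinarith [Nat.mul_le_mul_left (2 ^ k) hcl]
      have h5 : (2 : ℝ) ^ (k + u) ≤ 2 * cost D l A := by exact_mod_cast h4
      rw [← div_eq_mul_inv, inv_le_comm₀ hApos (by positivity), inv_div,
        div_le_iff₀ (by norm_num)]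
      linarith
    have hcard' : (F.card : ℝ) * cost D l A₀ ≤
        ((2 ^ c * s ^ 4 * (s ^ 4) ^ 32 : ℕ) : ℝ) * 2 ^ (k + u) := by
      have : F.card * cost D l A₀ ≤ 2 ^ c * s ^ 4 * (s ^ 4) ^ 32 * 2 ^ (k + u) :=
        hcard.trans (Nat.mul_le_mul_right _ (Nat.mul_le_mul_right _ (Nat.mul_le_mul_left _ hτs)))
      exact_mod_cast this
    calc ∑ A ∈ F, ((cost D l A : ℝ))⁻¹ ≤ ∑ _A ∈ F, 2 * ((2 : ℝ) ^ (k + u))⁻¹ :=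
          Finset.sum_le_sum hterm
      _ = 2 * (F.card * ((2 : ℝ) ^ (k + u))⁻¹) := by
          rw [Finset.sum_const, nsmul_eq_mul]; ring
      _ ≤ 2 * (((2 ^ c * s ^ 4 * (s ^ 4) ^ 32 : ℕ) : ℝ) * (cost D l A₀ : ℝ)⁻¹) := by
          refine mul_le_mul_of_nonneg_left ?_ (by norm_num)
          rw [← div_eq_mul_inv, ← div_eq_mul_inv,
            div_le_div_iff₀ (by positivity) (hpos A₀ hA₀)]
          exact hcard'
      _ = _ := by push_cast; ring
  rw [← Finset.sum_fiberwise_of_maps_to hκ]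
  refine (Finset.sum_le_sum hfib).trans ?_
  rw [Finset.sum_const, Finset.card_product, Finset.card_range, Finset.card_range, nsmul_eq_mul,
    ← mul_assoc]
  refine mul_le_mul_of_nonneg_right ?_ (inv_nonneg.2 (hpos A₀ hA₀).le)
  have hfin : (K + 1) * (n * l + 1) * (2 ^ (c + 1) * s ^ 4 * (s ^ 4) ^ 32) ≤
      s ^ (c + 1 + 4 + 128 + 8) := by
    calc (K + 1) * (n * l + 1) * (2 ^ (c + 1) * s ^ 4 * (s ^ 4) ^ 32)
        ≤ s ^ 4 * s ^ 4 * (s ^ (c + 1) * s ^ 4 * (s ^ 4) ^ 32) :=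
          Nat.mul_le_mul (Nat.mul_le_mul hKs hUs) (Nat.mul_le_mul_right _
            (Nat.mul_le_mul_right _ (Nat.pow_le_pow_left hs2 _)))
      _ = s ^ (c + 1 + 4 + 128 + 8) := by ring
  have hcast : (n : ℝ) + l = ((s : ℕ) : ℝ) := by rw [hs]; push_cast; rfl
  rw [hcast]
  exact_mod_cast hfin

end Cost

/-! ### Neighborhoods and mixtures in terms of cost. -/

section Prediction

variable {D : Str →. Str} {𝒜 : Set (Finset Str)} {m : Str → ℝ}

theorem mem_models {n l : ℕ} {x : Fin l → Str} {A : Finset Str} :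
    A ∈ models 𝒜 n x ↔ A ⊆ cube n ∧ A ∈ 𝒜 ∧ ∀ i, x i ∈ A := by
  simp [models]

theorem isModel_cons_ofFn {n l : ℕ} {x : Fin l → Str} {y : Str} {A : Finset Str} :
    IsModel 𝒜 n (y :: List.ofFn x) A ↔ A ∈ models 𝒜 n x ∧ y ∈ A := by
  simp only [IsModel, mem_models, List.mem_cons, List.mem_ofFn]
  constructor
  · rintro ⟨h1, h2, h3⟩
    exact ⟨⟨h2, h1, fun i => h3 _ (Or.inr ⟨i, rfl⟩)⟩, h3 _ (Or.inl rfl)⟩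
  · rintro ⟨⟨h1, h2, h3⟩, h4⟩
    refine ⟨h2, h1, ?_⟩
    rintro w (rfl | ⟨i, rfl⟩)
    · exact h4
    · exact h3 i

theorem two_rpow_add_mul_logb (d : ℝ) (c : ℕ) {s : ℝ} (hs : 0 < s) :
    (2 : ℝ) ^ (d + c * Real.logb 2 s) = 2 ^ d * s ^ c := by
  rw [Real.rpow_add (by norm_num), mul_comm (c : ℝ), Real.rpow_mul (by norm_num),
    Real.rpow_logb (by norm_num) (by norm_num) hs, Real.rpow_natCast]

theorem card_pos_of_mem_models {n l : ℕ} (hl : 1 ≤ l) {x : Fin l → Str} {A : Finset Str}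
    (hA : A ∈ models 𝒜 n x) : 0 < A.card :=
  Finset.card_pos.2 ⟨x ⟨0, hl⟩, (mem_models.1 hA).2.2 _⟩

theorem cost_pos_of_mem_models {n l : ℕ} (hl : 1 ≤ l) {x : Fin l → Str} {A : Finset Str}
    (hA : A ∈ models 𝒜 n x) : 0 < cost D l A := by
  have := card_pos_of_mem_models hl hA
  unfold cost
  positivity

theorem deficiency_le_iff {n l : ℕ} (hl : 1 ≤ l) {x : Fin l → Str} {A B : Finset Str}
    (hA : A ∈ models 𝒜 n x) (hB : B ∈ models 𝒜 n x) (d : ℝ) :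
    deficiency D x A ≤ deficiency D x B + d ↔ (cost D l A : ℝ) ≤ 2 ^ d * cost D l B := by
  have h : ∀ A ∈ models 𝒜 n x,
      deficiency D x A = Real.logb 2 (cost D l A) - tupleComplexity D x := by
    intro A hA
    have h0 : (A.card : ℝ) ≠ 0 := by exact_mod_cast (card_pos_of_mem_models hl hA).ne'
    rw [deficiency, cost, Nat.cast_mul, Nat.cast_pow, Nat.cast_pow,
      Real.logb_mul (by positivity) (pow_ne_zero _ h0), Real.logb_pow, Real.logb_pow]
    simp
  have hA0 : (0 : ℝ) < cost D l A := by exact_mod_cast cost_pos_of_mem_models hl hA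
  have hB0 : (0 : ℝ) < cost D l B := by exact_mod_cast cost_pos_of_mem_models hl hB
  rw [h A hA, h B hB, ← Real.logb_le_logb (b := 2) (by norm_num) hA0 (by positivity),
    Real.logb_mul (by positivity) hB0.ne', Real.logb_rpow (by norm_num) (by norm_num)]
  constructor <;> intro h <;> linarith

/-- The contribution of a model to the mixture. -/
noncomputable def weight (m : Str → ℝ) (l : ℕ) (A : Finset Str) : ℝ :=
  m (setCode A) / (A.card : ℝ) ^ l

theorem weight_mul_cost {l : ℕ} {A : Finset Str} (hA : 0 < A.card) :
    weight m l A * cost D l A = m (setCode A) * 2 ^ complexity D (setCode A) := by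
  have h0 : (A.card : ℝ) ≠ 0 := by exact_mod_cast hA.ne'
  rw [weight, cost, setComplexity]
  push_cast
  field_simp

/-- Up to a polynomial factor, the mixture over all models of bounded complexity is the inverse of
the least cost of a model. -/
theorem exists_mixture_bounds (hD : IsOptimal D) (hm : IsAPrioriProbability m)
    (h𝒜 : IsDecidableFamily 𝒜) :
    ∃ (c : ℕ) (c₁ c₂ : ℝ), 0 < c₁ ∧ 0 < c₂ ∧ c₁ * c₂ ≤ 2 ^ c ∧
      ∀ (n l : ℕ) (X : List Str), 1 ≤ n → 1 ≤ l → X.length = l + 1 → (∀ w ∈ X, w.length = n) →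
      ∀ S : Finset (Finset Str), (∀ A ∈ S, IsModel 𝒜 n X A ∧ setComplexity D A ≤ (l + 3) * n) →
      (∀ A₀, IsModel 𝒜 n X A₀ → (∀ B, IsModel 𝒜 n X B → cost D l A₀ ≤ cost D l B) →
        ∑ A ∈ S, weight m l A ≤ c₁ * ((n : ℝ) + l) ^ c * (cost D l A₀ : ℝ)⁻¹) ∧
      ∀ A ∈ S, (cost D l A : ℝ)⁻¹ ≤ c₂ * ((n : ℝ) + l) ^ 8 * ∑ A ∈ S, weight m l A := by
  obtain ⟨c₁, hc₁, h₁⟩ := hm.1.mul_two_pow_complexity_le hD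
  obtain ⟨c₂, hc₂, h₂⟩ := hm.one_le_mul_complexity hD
  obtain ⟨c₃, h₃⟩ := sum_inv_cost_le hD h𝒜
  -- The exponent is enlarged so that the constant c₁c₂ can later be absorbed into a power of n + l
  -- ≥ 2.
  obtain ⟨p, hp⟩ := pow_unbounded_of_one_lt (c₁ * c₂) (by norm_num : (1 : ℝ) < 2)
  refine ⟨p + c₃, c₁, c₂, hc₁, hc₂, hp.le.trans (pow_le_pow_right₀ (by norm_num) (by omega)),
    fun n l X hn hl hXl hX S hS => ⟨fun A₀ hA₀ hmin => ?_, fun A hA => ?_⟩⟩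
  · have hXne : X ≠ [] := by
      rintro rfl
      simp at hXl
    have hs : (1 : ℝ) ≤ (n : ℝ) + l := by exact_mod_cast (by omega : 1 ≤ n + l)
    calc ∑ A ∈ S, weight m l A ≤ ∑ A ∈ S, c₁ * (cost D l A : ℝ)⁻¹ := by
          refine Finset.sum_le_sum fun A hA => ?_
          have hA0 : 0 < cost D l A := cost_pos hXne (hS A hA).1
          have hcard : 0 < A.card ^ l := Nat.pos_of_mul_pos_left hA0
          have hA0' : (0 : ℝ) < cost D l A := by exact_mod_cast hA0
          rw [← div_eq_mul_inv, le_div_iff₀ hA0',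
            weight_mul_cost (Nat.pos_of_ne_zero fun h => by simp [h, show l ≠ 0 by omega] at hcard)]
          exact h₁ _
      _ = c₁ * ∑ A ∈ S, (cost D l A : ℝ)⁻¹ := by rw [Finset.mul_sum]
      _ ≤ c₁ * (((n : ℝ) + l) ^ c₃ * (cost D l A₀ : ℝ)⁻¹) :=
          mul_le_mul_of_nonneg_left (h₃ n l X hn hl hXl hX S hS A₀ hA₀ hmin) hc₁.le
      _ ≤ c₁ * (((n : ℝ) + l) ^ (p + c₃) * (cost D l A₀ : ℝ)⁻¹) := by
          gcongr
          omega
      _ = _ := by ring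
  · have hw : ∀ B ∈ S, 0 ≤ weight m l B := fun B _ =>
      div_nonneg (hm.1.nonneg _) (by positivity)
    have hXne : X ≠ [] := by
      rintro rfl
      simp at hXl
    have hA0 : 0 < cost D l A := cost_pos hXne (hS A hA).1
    have hcard : 0 < A.card ^ l := Nat.pos_of_mul_pos_left hA0
    have hcard' : 0 < A.card :=
      Nat.pos_of_ne_zero fun h => by simp [h, show l ≠ 0 by omega] at hcard
    have hA0' : (0 : ℝ) < cost D l A := by exact_mod_cast hA0
    have hpoly : ((complexity D (setCode A) : ℝ) + 1) * (complexity D (setCode A) + 2) ≤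
        ((n : ℝ) + l) ^ 8 := by
      have hC : complexity D (setCode A) ≤ (l + 3) * n := (hS A hA).2
      have hs2 : 2 ≤ n + l := by omega
      have hnl : n * l ≤ (n + l) ^ 2 := by
        rw [sq]; exact Nat.mul_le_mul (by omega) (by omega)
      have hss : 2 * (n + l) ≤ (n + l) ^ 2 := by nlinarith
      have hs24 : 4 * (n + l) ^ 2 ≤ (n + l) ^ 4 := by nlinarith
      have hK : complexity D (setCode A) + 2 ≤ (n + l) ^ 4 := by nlinarith
      have : (complexity D (setCode A) + 1) * (complexity D (setCode A) + 2) ≤ (n + l) ^ 8 := by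
        calc _ ≤ (n + l) ^ 4 * (n + l) ^ 4 := Nat.mul_le_mul (by omega) hK
          _ = _ := by ring
      exact_mod_cast this
    have hwA : (cost D l A : ℝ)⁻¹ ≤ c₂ * ((n : ℝ) + l) ^ 8 * weight m l A := by
      rw [inv_le_iff_one_le_mul₀ hA0', mul_assoc, weight_mul_cost hcard']
      refine (h₂ (setCode A)).trans ?_
      have : 0 ≤ m (setCode A) * 2 ^ complexity D (setCode A) :=
        mul_nonneg (hm.1.nonneg _) (by positivity)
      gcongr
    exact hwA.trans (mul_le_mul_of_nonneg_left (Finset.single_le_sum hw hA) (by positivity))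

/-- A replacement is made only when the model is too complex, so that it lowers both the complexity
and the size, hence the cost. -/
theorem exists_cheap_model (hD : IsOptimal D) (h𝒜 : IsDecidableFamily 𝒜) :
    ∃ N : ℕ, ∀ (n l : ℕ) (X : List Str) (A : Finset Str), 1 ≤ n → N ≤ n + l →
      X.length = l + 1 → (∀ w ∈ X, w.length = n) → IsModel 𝒜 n X A →
      ∃ A', IsModel 𝒜 n X A' ∧ setComplexity D A' ≤ (l + 3) * n ∧ cost D l A' ≤ cost D l A := by
  obtain ⟨N, hN⟩ := exists_model_of_bounded_complexity hD h𝒜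
  refine ⟨N, fun n l X A hn hs hXl hX hA => ?_⟩
  rcases Nat.le_total (setComplexity D A) ((l + 3) * n) with h | h
  · exact ⟨A, hA, h, le_rfl⟩
  · obtain ⟨A', hA', hcard, hC⟩ := hN n l X A hn hs hXl hX hA
    exact ⟨A', hA', hC, Nat.mul_le_mul (Nat.pow_le_pow_right (by norm_num) (hC.trans h))
      (Nat.pow_le_pow_left hcard l)⟩

open Classical in
/-- The models of `x` of bounded complexity that contain `y`. -/
noncomputable def simpleModels (D : Str →. Str) (𝒜 : Set (Finset Str)) (n : ℕ) {l : ℕ}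
    (x : Fin l → Str) (y : Str) : Finset (Finset Str) :=
  (models 𝒜 n x).filter fun A => setComplexity D A ≤ (l + 3) * n ∧ y ∈ A

theorem mem_simpleModels {n l : ℕ} {x : Fin l → Str} {y : Str} {A : Finset Str} :
    A ∈ simpleModels D 𝒜 n x y ↔
      IsModel 𝒜 n (y :: List.ofFn x) A ∧ setComplexity D A ≤ (l + 3) * n := by
  rw [isModel_cons_ofFn, simpleModels, Finset.mem_filter]
  tauto

/-- Repeating an entry of `x` in the role of `y` turns the denominator into a numerator, so that a
single estimate for tuples of length l + 1 serves both sums. -/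
theorem predProb_eq {n l : ℕ} (hl : 1 ≤ l) (x : Fin l → Str) (y : Str) :
    predProb D m 𝒜 n x y = (∑ A ∈ simpleModels D 𝒜 n x y, weight m l A) /
      ∑ A ∈ simpleModels D 𝒜 n x (x ⟨0, hl⟩), weight m l A := by
  classical
  have h : (models 𝒜 n x).filter (fun A => setComplexity D A ≤ (l + 3) * n) =
      simpleModels D 𝒜 n x (x ⟨0, hl⟩) := by
    ext A
    simp only [simpleModels, Finset.mem_filter]
    refine and_congr_right fun hA => ?_
    simp [(mem_models.1 hA).2.2]
  rw [← h]
  simp only [predProb, simpleModels, weight]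

theorem simpleModels_subset {n l : ℕ} (hl : 1 ≤ l) (x : Fin l → Str) (y : Str) :
    simpleModels D 𝒜 n x y ⊆ simpleModels D 𝒜 n x (x ⟨0, hl⟩) := by
  intro A hA
  rw [mem_simpleModels, isModel_cons_ofFn] at hA ⊢
  exact ⟨⟨hA.1.1, (mem_models.1 hA.1.1).2.2 _⟩, hA.2⟩

theorem predProb_le_one (hm : IsAPrioriProbability m) {n l : ℕ} (hl : 1 ≤ l) (x : Fin l → Str)
    (y : Str) : predProb D m 𝒜 n x y ≤ 1 := by
  have hw : ∀ B, 0 ≤ weight m l B := fun B => div_nonneg (hm.1.nonneg _) (by positivity)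
  rw [predProb_eq hl]
  refine div_le_one_of_le₀ ?_ (Finset.sum_nonneg fun B _ => hw B)
  exact Finset.sum_le_sum_of_subset_of_nonneg (simpleModels_subset hl x y) fun B _ _ => hw B

/-- Covers the finitely many pairs n + l < N in part (b), where complex models cannot be replaced.
-/
theorem exists_cost_bound (D : Str →. Str) (N : ℕ) :
    ∃ p : ℕ, ∀ n l, n + l < N → ∀ A ⊆ cube n, cost D l A ≤ 2 ^ p := by
  obtain ⟨K, hK⟩ := exists_setComplexity_bound D N
  refine ⟨K + N * N, fun n l h A hA => ?_⟩
  rw [pow_add, cost]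
  refine Nat.mul_le_mul (Nat.pow_le_pow_right (by norm_num) (hK n (by omega) A hA)) ?_
  calc A.card ^ l ≤ (2 ^ n) ^ l :=
        Nat.pow_le_pow_left (card_le_two_pow_of_length fun w hw => mem_cube.1 (hA hw)) l
    _ = 2 ^ (n * l) := (pow_mul 2 n l).symm
    _ ≤ _ := Nat.pow_le_pow_right (by norm_num) (Nat.mul_le_mul (by omega) (by omega))

end Prediction

end AlgStat

open AlgStat in
theorem mainTheorem2 (D : AlgStat.Str →. AlgStat.Str) (hD : AlgStat.IsOptimal D)
    (m : AlgStat.Str → ℝ) (hm : AlgStat.IsAPrioriProbability m)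
    (𝒜 : Set (Finset AlgStat.Str)) (h𝒜 : AlgStat.IsDecidableFamily 𝒜) :
    ∃ (c : ℝ) (N : ℕ), ∀ (n l : ℕ), 1 ≤ l →
      ∀ x : Fin l → AlgStat.Str, (∀ i, (x i).length = n) → ∀ d : ℝ,
        (1 ≤ n → N ≤ n + l →
          AlgStat.algNeighborhood D 𝒜 n x d ⊆
            AlgStat.probNeighborhood D m 𝒜 n x (d + c * Real.logb 2 ((n : ℝ) + (l : ℝ)))) ∧
        AlgStat.probNeighborhood D m 𝒜 n x d ⊆
          AlgStat.algNeighborhood D 𝒜 n x (d + c * Real.logb 2 ((n : ℝ) + (l : ℝ))) := by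
  obtain ⟨c, c₁, c₂, hc₁, hc₂, hcc, hmix⟩ := exists_mixture_bounds hD hm h𝒜
  obtain ⟨N, hN⟩ := exists_cheap_model hD h𝒜
  obtain ⟨p, hp⟩ := exists_cost_bound D N
  -- One `c` and the 8 come from the upper and lower mixture bounds, the other `c` absorbs c₁c₂ ≤
  -- 2^c, and `p` absorbs the cost bound for n + l < N.
  refine ⟨((c + c + 8 + p : ℕ) : ℝ), N, fun n l hl x hx d => ?_⟩
  have hs1 : (1 : ℝ) ≤ (n : ℝ) + l := by exact_mod_cast (by omega : 1 ≤ n + l)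
  have hs0 : (0 : ℝ) < (n : ℝ) + l := by linarith
  have hcost : ∀ {A}, A ∈ models 𝒜 n x → (0 : ℝ) < cost D l A := fun hA => by
    exact_mod_cast cost_pos_of_mem_models hl hA
  have hYl : ∀ y : Str, (y :: List.ofFn x).length = l + 1 := fun y => by simp
  have hY : ∀ {y : Str} {A}, IsModel 𝒜 n (y :: List.ofFn x) A →
      ∀ w ∈ y :: List.ofFn x, w.length = n := fun hA w hw => mem_cube.1 (hA.2.1 (hA.2.2 w hw))
  have hX : ∀ A, A ∈ models 𝒜 n x ↔ IsModel 𝒜 n (x ⟨0, hl⟩ :: List.ofFn x) A := fun A => by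
    rw [isModel_cons_ofFn]
    exact (and_iff_left_of_imp fun hA => (mem_models.1 hA).2.2 _).symm
  have hconst : 1 ≤ n → c₁ * ((n : ℝ) + l) ^ c * (c₂ * ((n : ℝ) + l) ^ 8) ≤
      ((n : ℝ) + l) ^ (c + c + 8 + p) := by
    intro hn
    have hs2 : (2 : ℝ) ≤ (n : ℝ) + l := by exact_mod_cast (by omega : 2 ≤ n + l)
    calc c₁ * ((n : ℝ) + l) ^ c * (c₂ * ((n : ℝ) + l) ^ 8)
        = (c₁ * c₂) * ((n : ℝ) + l) ^ (c + 8) := by ring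
      _ ≤ ((n : ℝ) + l) ^ c * ((n : ℝ) + l) ^ (c + 8) := by
          gcongr
          exact hcc.trans (pow_le_pow_left₀ (by norm_num) hs2 c)
      _ = ((n : ℝ) + l) ^ (c + c + 8) := by ring
      _ ≤ _ := pow_le_pow_right₀ hs1 (by omega)
  set s : ℝ := (n : ℝ) + l
  set S := fun y => ∑ A ∈ simpleModels D 𝒜 n x y, weight m l A
  refine ⟨fun hn hNs y hy => ?_, fun y hy => ?_⟩
  · obtain ⟨A, hA, hmin, hyA⟩ := hy
    have hAY := isModel_cons_ofFn.2 ⟨hA, hyA⟩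
    obtain ⟨A', hA', hA'C, hA'A⟩ := hN n l _ A hn hNs (hYl y) (hY hAY) hAY
    have hA'x := (isModel_cons_ofFn.1 hA').1
    -- `A₀` minimises over all models of `x`, with no bound on complexity; the upper mixture bound
    -- allows this.
    obtain ⟨A₀, hA₀, hA₀min⟩ := exists_min_cost D l ((hX A').1 hA'x)
    have hnum := (hmix n l _ hn hl (hYl y) (hY hAY) (simpleModels D 𝒜 n x y)
      (fun B hB => mem_simpleModels.1 hB)).2 A' (mem_simpleModels.2 ⟨hA', hA'C⟩)
    obtain ⟨hden, hden'⟩ := hmix n l _ hn hl (hYl _) (hY hA₀)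
      (simpleModels D 𝒜 n x (x ⟨0, hl⟩)) (fun B hB => mem_simpleModels.1 hB)
    have hden0 : 0 < S (x ⟨0, hl⟩) := by
      have h1 := hden' A' (mem_simpleModels.2 ⟨(hX A').1 hA'x, hA'C⟩)
      exact pos_of_mul_pos_right ((inv_pos.2 (hcost hA'x)).trans_le h1) (by positivity)
    have hdef := (deficiency_le_iff hl hA ((hX A₀).2 hA₀) d).1 (hmin A₀ ((hX A₀).2 hA₀))
    have hA'A' : (cost D l A' : ℝ) ≤ 2 ^ d * cost D l A₀ := le_trans (by exact_mod_cast hA'A) hdef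
    have h0 := hcost ((hX A₀).2 hA₀)
    have hinv : (cost D l A₀ : ℝ)⁻¹ ≤ 2 ^ d * (cost D l A' : ℝ)⁻¹ := by
      rw [inv_le_iff_one_le_mul₀ h0, mul_right_comm, ← div_eq_mul_inv, one_le_div (hcost hA'x)]
      exact hA'A'
    change (2 : ℝ) ^ (-(d + _ * Real.logb 2 s)) ≤ predProb D m 𝒜 n x y
    rw [predProb_eq hl, le_div_iff₀ hden0, Real.rpow_neg (by norm_num),
      two_rpow_add_mul_logb d _ hs0, inv_mul_le_iff₀ (by positivity)]
    have hSy : 0 ≤ S y := Finset.sum_nonneg fun B _ => div_nonneg (hm.1.nonneg _) (by positivity)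
    calc S (x ⟨0, hl⟩) ≤ c₁ * s ^ c * (cost D l A₀ : ℝ)⁻¹ := hden A₀ hA₀ hA₀min
      _ ≤ c₁ * s ^ c * (2 ^ d * (c₂ * s ^ 8 * S y)) := by
          gcongr
          exact hinv.trans (mul_le_mul_of_nonneg_left hnum (by positivity))
      _ = 2 ^ d * (c₁ * s ^ c * (c₂ * s ^ 8)) * S y := by ring
      _ ≤ 2 ^ d * s ^ (c + c + 8 + p) * S y := by
          gcongr
          exact hconst hn
  · have hy' : (2 : ℝ) ^ (-d) ≤ predProb D m 𝒜 n x y := hy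
    -- As p(y | x) ≤ 1, a nonempty neighborhood forces d ≥ 0. This is what settles the degenerate
    -- cases below.
    have hd : 0 ≤ d := by
      have h1 := hy'.trans (predProb_le_one hm hl x y)
      have := (Real.rpow_le_one_iff_of_pos (by norm_num)).1 h1
      rcases this with h | h
      · linarith [h.2]
      · norm_num at h
    have hpos : 0 < predProb D m 𝒜 n x y := lt_of_lt_of_le (by positivity) hy'
    rw [predProb_eq hl] at hy' hpos
    have hne : (simpleModels D 𝒜 n x y).Nonempty := by
      rw [Finset.nonempty_iff_ne_empty]
      intro h
      rw [h] at hpos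
      simp at hpos
    obtain ⟨A, hA⟩ := hne
    have hAY := (mem_simpleModels.1 hA).1
    obtain ⟨hAx, hyA⟩ := isModel_cons_ofFn.1 hAY
    -- The cheapest model of `x` together with `y` witnesses membership of `y` in the algorithmic
    -- neighborhood.
    obtain ⟨A₁, hA₁, hA₁min⟩ := exists_min_cost D l hAY
    obtain ⟨hA₁x, hyA₁⟩ := isModel_cons_ofFn.1 hA₁
    refine ⟨A₁, hA₁x, fun B hB => ?_, hyA₁⟩
    rw [deficiency_le_iff hl hA₁x hB, two_rpow_add_mul_logb d _ hs0]
    have h2d : (1 : ℝ) ≤ 2 ^ d := Real.one_le_rpow (by norm_num) hd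
    -- For n = 0 and l = 1 the logarithm vanishes and absorbs no constant, but then {[]} is the only
    -- possible model and d ≥ 0 is enough.
    rcases Nat.eq_zero_or_pos n with rfl | hn
    · have hcube : ∀ B ∈ models 𝒜 0 x, B = {[]} := by
        intro B hB
        refine Finset.Subset.antisymm (fun w hw => ?_) (Finset.singleton_subset_iff.2 ?_)
        · have := mem_cube.1 ((mem_models.1 hB).1 hw)
          simpa using List.length_eq_zero_iff.1 this
        · have h1 := (mem_models.1 hB).2.2 ⟨0, hl⟩
          rwa [List.length_eq_zero_iff.1 (hx ⟨0, hl⟩)] at h1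
      rw [hcube B hB, hcube A₁ hA₁x]
      exact le_mul_of_one_le_left (Nat.cast_nonneg _)
        (one_le_mul_of_one_le_of_one_le h2d (one_le_pow₀ hs1))
    · rcases Nat.lt_or_ge (n + l) N with hlt | hge
      · have hs2 : (2 : ℝ) ≤ s := by
          have : (2 : ℝ) ≤ ((n + l : ℕ) : ℝ) := by exact_mod_cast (by omega : 2 ≤ n + l)
          simpa [s] using this
        have hB1 : (1 : ℝ) ≤ cost D l B := by
          exact_mod_cast cost_pos_of_mem_models (D := D) hl hB
        calc (cost D l A₁ : ℝ) ≤ 2 ^ p := by exact_mod_cast hp n l hlt A₁ (mem_models.1 hA₁x).1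
          _ ≤ s ^ p := pow_le_pow_left₀ (by norm_num) hs2 p
          _ ≤ s ^ (c + c + 8 + p) := pow_le_pow_right₀ hs1 (by omega)
          _ ≤ 2 ^ d * s ^ (c + c + 8 + p) * cost D l B := by
              rw [mul_assoc]
              refine (le_mul_of_one_le_right (by positivity) hB1).trans ?_
              exact le_mul_of_one_le_left (by positivity) h2d
      · have hBX := (hX B).1 hB
        -- The competitor `B` may be too complex to occur in the denominator; its cheaper
        -- replacement `B'` does occur there.
        obtain ⟨B', hB', hB'C, hB'B⟩ := hN n l _ B hn hge (hYl _) (hY hBX) hBX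
        have hden := (hmix n l _ hn hl (hYl _) (hY hBX)
          (simpleModels D 𝒜 n x (x ⟨0, hl⟩)) (fun B hB => mem_simpleModels.1 hB)).2 B'
          (mem_simpleModels.2 ⟨hB', hB'C⟩)
        have hnum := (hmix n l _ hn hl (hYl y) (hY hAY) (simpleModels D 𝒜 n x y)
          (fun B hB => mem_simpleModels.1 hB)).1 A₁ hA₁ hA₁min
        have hB'0 := hcost ((hX B').2 hB')
        have hden0 : 0 < S (x ⟨0, hl⟩) :=
          pos_of_mul_pos_right ((inv_pos.2 hB'0).trans_le hden) (by positivity)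
        rw [le_div_iff₀ hden0, Real.rpow_neg (by norm_num), inv_mul_le_iff₀ (by positivity)] at hy'
        have hA₁0 := hcost hA₁x
        have h1 : (cost D l B' : ℝ)⁻¹ ≤
            2 ^ d * (c₁ * s ^ c * (c₂ * s ^ 8)) * (cost D l A₁ : ℝ)⁻¹ := by
          calc (cost D l B' : ℝ)⁻¹ ≤ c₂ * s ^ 8 * S (x ⟨0, hl⟩) := hden
            _ ≤ c₂ * s ^ 8 * (2 ^ d * (c₁ * s ^ c * (cost D l A₁ : ℝ)⁻¹)) := by
                gcongr
                exact hy'.trans (mul_le_mul_of_nonneg_left hnum (by positivity))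
            _ = _ := by ring
        rw [inv_le_iff_one_le_mul₀ hB'0, mul_right_comm, ← div_eq_mul_inv, one_le_div hA₁0] at h1
        refine h1.trans ?_
        gcongr
        · exact hconst hn
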